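/- Let $n=2p$ with $p\ge 2$. Let $\xi_1,\dots,\xi_p\in\mathbb C$ be pairwise distinct, let $c_1,\dots,c_p\in\mathbb C\setminus\{0\}$, put $s_k=\sum_{h=1}^p c_h\xi_h^k$ for $0\le k\le n-1$, and fix $j\in\{1,\dots,p\}$. For $z\in\mathbb C$ and $\zeta=(\zeta_h)_{h\ne j}\in\mathbb C^{p-1}$ let $x_j=z$ and $x_h=\zeta_h$ for $h\neq j$. Let $X_j\in\mathbb C^{p\times n}$ be the matrix with entries $\bar x_h^{\,k}$, $0\le k\le n-1$, and let $Q_j=X_jX_j^H$, $q_j=X_js$, $$\nu_j(\zeta,z)=s^H\bigl(I_n-X_j^HQ_j^{-1}X_j\bigr)s .$$ Let $$\tilde Q_j=\begin{pmatrix}\Re Q_j&-\Im Q_j\\ \Im Q_j&\Re Q_j\end{pmatrix},\quad \tilde q_j=\begin{pmatrix}\Re q_j\\ \Im q_j\end{pmatrix},\quad \hat Q_j=\operatorname{adj}\tilde Q_j,\quad D_j=\det\tilde Q_j,\quad A_i=I_2\otimes e_ie_i^T,$$ $$\beta_0=\prod_{i=1}^p \tilde q_j^T\hat Q_jA_i\hat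 Q_j\tilde q_j,\qquad K_j(\zeta,z)=\frac{1}{\pi^{n/2}}\,\beta_0\,\frac{\prod_{r<h}|x_r-x_h|^8}{D_j^{\,n+1/2}},\qquad G_j(\zeta,z)=(2\pi)^{\frac n2-1}|H_j(\zeta,z)|^{-1/2}K_j(\zeta,z),$$ where $|H_j|$ is the determinant of the Hessian $H_j$ of $\nu_j(\cdot,z)$ with respect to the $n-2$ real variables $\Re\zeta,\Im\zeta$. For $\sigma>0$ and a region $\mathcal D\subseteq\mathbb C^{p-1}$ let $$I_{\mathcal D}(z,\sigma)=\frac1{(\pi\sigma^2)^n}\int_{\mathcal D}\int_{\mathbb C^{p}}\Bigl|\prod_{h}\gamma_h\prod_{r<h}(x_r-x_h)^4\Bigr|^2\exp\Bigl(-\frac1{\sigma^2}\sum_{k=0}^{n-1}\Bigl|\sum_h\gamma_hx_h^k-s_k\Bigr|^2\Bigr)\,d\gamma\,d\zeta ,$$ and let the $j$-th condensed density be the integral over all unordered configurations $\{\zeta_h:h\ne j\}$, $$h_n^{(j)}(z,\sigma)=\frac{1}{(n/2-1)!}\,I_{\mathbb C^{p-1}}(z,\sigma).$$ **Theorem.**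 There are an open neighbourhood $\mathcal N_j$ of $\xi_j$, an open neighbourhood $\mathcal D_j$ of $(\xi_h)_{h\ne j}$ and a continuous map $z\mapsto\hat\zeta^{(j)}(z)\in\mathcal D_j$ on $\mathcal N_j$ with $\hat\zeta^{(j)}(\xi_j)=(\xi_h)_{h\neq j}$, such that for every $z\in\mathcal N_j$: the point $\hat\zeta^{(j)}=\hat\zeta^{(j)}(z)$ is the unique minimum point of $\nu_j(\cdot,z)$ in $\mathcal D_j$, the Hessian $H_j(\hat\zeta^{(j)},z)$ is positive definite, $G_j(\hat\zeta^{(j)},z)>0$, and $$h_n^{(j)}(z,\sigma)\sim\sigma^{-2}\,G_j(\hat\zeta^{(j)},z)\,e^{-\nu_j(\hat\zeta^{(j)},z)/\sigma^2}\qquad(\sigma\downarrow0),$$ where $\sim$ means that the ratio of the two sides tends to $1$. The same asymptotic equivalence holds with $I_{\mathcal D_j}(z,\sigma)$ in place of $h_n^{(j)}(z,\sigma)$. -/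

import Mathlib

open scoped Matrix Topology Asymptotics

noncomputable section

/-- The noiseless signal `s_k = ∑ₕ cₕ ξₕᵏ`, `k = 0, …, n - 1`, with `n = 2 p`. -/
def signal (p : ℕ) (ξ c : Fin p → ℂ) : Fin (2 * p) → ℂ :=
  fun k => ∑ h, c h * ξ h ^ (k : ℕ)

/-- All `p` nodes: the value `z` at the index `j`, and `ζ` at the indices `h ≠ j`. -/
def nodes {p : ℕ} (j : Fin p) (ζ : {h : Fin p // h ≠ j} → ℂ) (z : ℂ) : Fin p → ℂ :=
  fun h => if hj : h = j then z else ζ ⟨h, hj⟩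

/-- The matrix `X_j` with entries `conj (x_h) ^ k`, `k = 0, …, n - 1`. -/
def matX {p : ℕ} (j : Fin p) (ζ : {h : Fin p // h ≠ j} → ℂ) (z : ℂ) :
    Matrix (Fin p) (Fin (2 * p)) ℂ :=
  Matrix.of fun h k => (starRingEnd ℂ (nodes j ζ z h)) ^ (k : ℕ)

/-- `Q_j = X_j X_jᴴ`. -/
def matQ {p : ℕ} (j : Fin p) (ζ : {h : Fin p // h ≠ j} → ℂ) (z : ℂ) :
    Matrix (Fin p) (Fin p) ℂ :=
  matX j ζ z * (matX j ζ z)ᴴ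

/-- `q_j = X_j s`. -/
def vecq {p : ℕ} (s : Fin (2 * p) → ℂ) (j : Fin p) (ζ : {h : Fin p // h ≠ j} → ℂ) (z : ℂ) :
    Fin p → ℂ :=
  matX j ζ z *ᵥ s

/-- `ν_j = sᴴ (I - X_jᴴ (X_j X_jᴴ)⁻¹ X_j) s` (a real number). -/
def nu {p : ℕ} (s : Fin (2 * p) → ℂ) (j : Fin p) (ζ : {h : Fin p // h ≠ j} → ℂ) (z : ℂ) : ℝ :=
  (star s ⬝ᵥ ((1 - (matX j ζ z)ᴴ * (matQ j ζ z)⁻¹ * matX j ζ z) *ᵥ s)).re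

/-- The real form of `Q_j`: the blocks `Re Q, -Im Q, Im Q, Re Q`. -/
def realQ {p : ℕ} (j : Fin p) (ζ : {h : Fin p // h ≠ j} → ℂ) (z : ℂ) :
    Matrix (Fin p ⊕ Fin p) (Fin p ⊕ Fin p) ℝ :=
  Matrix.fromBlocks ((matQ j ζ z).map Complex.re) (-((matQ j ζ z).map Complex.im))
    ((matQ j ζ z).map Complex.im) ((matQ j ζ z).map Complex.re)

/-- The real form of `q_j`: real parts stacked on imaginary parts. -/
def realq {p : ℕ} (s : Fin (2 * p) → ℂ) (j : Fin p) (ζ : {h : Fin p // h ≠ j} → ℂ) (z : ℂ) :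
    Fin p ⊕ Fin p → ℝ :=
  Sum.elim (fun h => (vecq s j ζ z h).re) (fun h => (vecq s j ζ z h).im)

/-- `A_i = I₂ ⊗ e_i e_iᵀ`. -/
def matA {p : ℕ} (i : Fin p) : Matrix (Fin p ⊕ Fin p) (Fin p ⊕ Fin p) ℝ :=
  Matrix.fromBlocks (Matrix.single i i 1) 0 0 (Matrix.single i i 1)

/-- `D_j`, the determinant of the real form of `Q_j`. -/
def detD {p : ℕ} (j : Fin p) (ζ : {h : Fin p // h ≠ j} → ℂ) (z : ℂ) : ℝ :=
  (realQ j ζ z).det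

/-- `β₀ = ∏ᵢ qᵀ adj(Q) A_i adj(Q) q`, with the real forms of `q_j` and `Q_j`. -/
def beta0 {p : ℕ} (s : Fin (2 * p) → ℂ) (j : Fin p) (ζ : {h : Fin p // h ≠ j} → ℂ) (z : ℂ) : ℝ :=
  ∏ i, realq s j ζ z ⬝ᵥ
    (((realQ j ζ z).adjugate * matA i * (realQ j ζ z).adjugate) *ᵥ realq s j ζ z)

/-- The Vandermonde product over all pairs of nodes, that is, over the pairs with both indices
different from `j` and the pairs of one such node with `z`. -/
def vander {p : ℕ} (j : Fin p) (ζ : {h : Fin p // h ≠ j} → ℂ) (z : ℂ) : ℂ :=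
  ∏ r, ∏ h ∈ Finset.Ioi r, (nodes j ζ z r - nodes j ζ z h)

/-- `K_j = π^(-n/2) β₀ ∏ |x_r - x_h|⁸ / D_j^(n + 1/2)`, with `n = 2 p`. -/
def funK {p : ℕ} (s : Fin (2 * p) → ℂ) (j : Fin p) (ζ : {h : Fin p // h ≠ j} → ℂ) (z : ℂ) : ℝ :=
  1 / Real.pi ^ p * beta0 s j ζ z * ‖vander j ζ z‖ ^ 8 /
    detD j ζ z ^ ((2 * p : ℝ) + 1 / 2)

/-- The coordinate directions of `ℂ^ι` as a real space: real parts stacked on imaginary parts. -/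
def realDir {ι : Type} [DecidableEq ι] : ι ⊕ ι → (ι → ℂ) :=
  Sum.elim (fun h => Pi.single h 1) (fun h => Pi.single h Complex.I)

/-- The Hessian of `F : ℂ^ι → ℝ` at `w` in the real coordinates (real and imaginary parts). -/
def realHessian {ι : Type} [Fintype ι] [DecidableEq ι] (F : (ι → ℂ) → ℝ) (w : ι → ℂ) :
    Matrix (ι ⊕ ι) (ι ⊕ ι) ℝ :=
  Matrix.of fun a b => fderiv ℝ (fun v => fderiv ℝ F v (realDir b)) w (realDir a)

/-- `H_j`, the Hessian of `ν_j(·, z)` in the `n - 2` real variables. -/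
def hessNu {p : ℕ} (s : Fin (2 * p) → ℂ) (j : Fin p) (ζ : {h : Fin p // h ≠ j} → ℂ) (z : ℂ) :
    Matrix ({h : Fin p // h ≠ j} ⊕ {h : Fin p // h ≠ j})
      ({h : Fin p // h ≠ j} ⊕ {h : Fin p // h ≠ j}) ℝ :=
  realHessian (fun w => nu s j w z) ζ

/-- `G_j = (2π)^(n/2 - 1) |H_j|^(-1/2) K_j`. -/
def funG {p : ℕ} (s : Fin (2 * p) → ℂ) (j : Fin p) (ζ : {h : Fin p // h ≠ j} → ℂ) (z : ℂ) : ℝ :=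
  (2 * Real.pi) ^ ((p : ℝ) - 1) * (hessNu s j ζ z).det ^ (-(1 / 2) : ℝ) * funK s j ζ z

/-- The complex Jacobian `(-1)^(n/2) ∏ γ_h ∏ (x_r - x_h)⁴` of the map from nodes and amplitudes
to the data `d_k = ∑ₕ γₕ xₕᵏ`. -/
def jacobianC {p : ℕ} (j : Fin p) (ζ : {h : Fin p // h ≠ j} → ℂ) (z : ℂ) (γ : Fin p → ℂ) : ℂ :=
  (-1) ^ p * (∏ h, γ h) * vander j ζ z ^ 4

/-- The integral
`(π σ²)^(-n) ∫_{ζ ∈ D} ∫_γ |J|² exp (-σ⁻² ∑ₖ |∑ₕ γₕ xₕᵏ - sₖ|²) dγ dζ`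
over ordered tuples `ζ` in the region `D`. The factor `|J|²` is the real Jacobian. -/
def densityIntegral {p : ℕ} (s : Fin (2 * p) → ℂ) (j : Fin p)
    (D : Set ({h : Fin p // h ≠ j} → ℂ)) (z : ℂ) (σ : ℝ) : ℝ :=
  1 / (Real.pi * σ ^ 2) ^ (2 * p) *
    ∫ ζ in D, ∫ γ : Fin p → ℂ, ‖jacobianC j ζ z γ‖ ^ 2 *
      Real.exp (-(1 / σ ^ 2) *
        ∑ k : Fin (2 * p), ‖∑ h, γ h * nodes j ζ z h ^ (k : ℕ) - s k‖ ^ 2)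

/-- The `j`-th condensed density `h_n^{(j)}(z, σ)`: the integral over all the unordered
configurations `{ζ_h : h ≠ j}` of the other eigenvalues. A configuration of distinct points
corresponds to `(p - 1)!` ordered tuples. -/
def condensedDensity {p : ℕ} (s : Fin (2 * p) → ℂ) (j : Fin p) (z : ℂ) (σ : ℝ) : ℝ :=
  1 / ((p - 1).factorial : ℝ) * densityIntegral s j Set.univ z σ

/-- `σ⁻² G_j(ζ, z) exp (-ν_j(ζ, z) / σ²)`. -/
def laplaceApprox {p : ℕ} (s : Fin (2 * p) → ℂ) (j : Fin p) (ζ : {h : Fin p // h ≠ j} → ℂ)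
    (z : ℂ) (σ : ℝ) : ℝ :=
  (σ ^ 2)⁻¹ * funG s j ζ z * Real.exp (-(nu s j ζ z) / σ ^ 2)

end

noncomputable section

open scoped ComplexOrder

/-! For fixed distinct nodes `x`, the exponent is a quadratic function of the amplitudes. Pythagoras
(`misfit_ampl_add`) splits it into its least squares value, which is `nu` (`nu_eq_misfit`), and the
form of the Gram matrix. Substituting `γ = ampl + σ η` turns the inner integral into `σ^(2p)
exp(-ν/σ²)` times `reducedIntegral`, which is continuous up to `σ = 0` (`amplitudeIntegral_eq`,
`continuousAt_reducedIntegral`). Its value there is a Gaussian integral, and since `adj(Q) q = D ·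
ampl`, it is `K_j` up to a power of `π` (`beta0_eq`, `funK_eq`). Laplace's method in the remaining
`2(p-1)` real variables supplies the Hessian factor and `σ^(2p-2)`; with the prefactor `σ^(-4p)`
this leaves `σ^(-2)` (`tendsto_laplace`, `densityIntegral_isEquivalent`).

The geometry of `ν` comes from reading the data as a linear functional on polynomials of degree
below `2p`. Test it on `g ∏ (X - x_k)`, where `g` is the Lagrange basis polynomial of `ξ_i`: the
fitted moments are annihilated, and the true ones give `c_i ∏ (ξ_i - x_k)`. Hence the misfit bounds
this product (`exists_prod_le_misfit`). Near the true nodes this means quadratic growth of `ν`,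
uniformly in `z`, and so a nondegenerate minimum that moves continuously with `z`
(`exists_minimizer_family`). Globally, a small misfit forces the nodes to be a permutation of the
true ones up to `ε` (`exists_perm_of_misfit_lt`).

The integral over all configurations is therefore `(p-1)!` equal copies of the local one plus a
region where the misfit is at least some `δ > ν`. That region is exponentially negligible as soon as
the integral converges at `σ = 1`. Convergence follows from a second family of test polynomials,
`X^m ∏_{k ≠ h} (X - x_k)`, which isolates one amplitude: in the resulting Gaussian bound the
Vandermonde factors cancel exactly and `∏ (1 + |x_h|)^(-4)` remains
(`norm_vand_pow_mul_prod_amplConst`). -/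

/-! ### Real forms of complex vectors and matrices -/

/-- Real parts of a complex vector stacked on its imaginary parts. -/
def realVec {ι : Type*} (v : ι → ℂ) : ι ⊕ ι → ℝ :=
  Sum.elim (fun h => (v h).re) (fun h => (v h).im)

/-- The real form of a complex square matrix. -/
def realForm {ι : Type*} (M : Matrix ι ι ℂ) : Matrix (ι ⊕ ι) (ι ⊕ ι) ℝ :=
  Matrix.fromBlocks (M.map Complex.re) (-(M.map Complex.im)) (M.map Complex.im) (M.map Complex.re)

lemma realForm_mulVec {ι : Type*} [Fintype ι] (M : Matrix ι ι ℂ) (v : ι → ℂ) :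
    realForm M *ᵥ realVec v = realVec (M *ᵥ v) := by
  ext i
  rcases i with i | i <;>
  simp [realForm, realVec, Matrix.mulVec, dotProduct, Fintype.sum_sum_type, Complex.re_sum,
    Complex.im_sum, Finset.sum_add_distrib, sub_eq_add_neg, add_comm]

lemma realVec_dotProduct {ι : Type*} [Fintype ι] (v w : ι → ℂ) :
    realVec v ⬝ᵥ realVec w = (star v ⬝ᵥ w).re := by
  simp [realVec, dotProduct, Fintype.sum_sum_type, Complex.re_sum, Finset.sum_add_distrib]

lemma realForm_transpose {ι : Type*} {M : Matrix ι ι ℂ} (hM : M.IsHermitian) :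
    (realForm M)ᵀ = realForm M := by
  have h : ∀ a b, M a b = starRingEnd ℂ (M b a) := fun a b => (hM.apply a b).symm
  ext a b
  rcases a with a | a <;> rcases b with b | b <;> simp [realForm] <;> rw [h b a] <;> simp

lemma realVec_surjective {ι : Type*} : Function.Surjective (realVec (ι := ι)) := fun y =>
  ⟨fun h => ⟨y (.inl h), y (.inr h)⟩, by ext i; rcases i with i | i <;> rfl⟩

lemma realVec_eq_zero {ι : Type*} {v : ι → ℂ} : realVec v = 0 ↔ v = 0 := by
  constructor
  · intro h
    ext i
    have h1 := congrFun h (.inl i)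
    have h2 := congrFun h (.inr i)
    exact Complex.ext h1 h2
  · rintro rfl
    ext i
    rcases i with i | i <;> rfl

lemma realForm_posDef {ι : Type*} [Fintype ι] {M : Matrix ι ι ℂ} (hM : M.PosDef) :
    (realForm M).PosDef := by
  refine Matrix.PosDef.of_dotProduct_mulVec_pos ?_ ?_
  · rw [Matrix.IsHermitian, Matrix.conjTranspose_eq_transpose_of_trivial]
    exact realForm_transpose hM.1
  · intro y hy
    obtain ⟨v, rfl⟩ := realVec_surjective y
    rw [star_trivial, realForm_mulVec, realVec_dotProduct]
    exact (Complex.pos_iff.1 (hM.dotProduct_mulVec_pos (fun h => hy (realVec_eq_zero.2 h)))).1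

/-! ### Least squares for given nodes -/

/-- The matrix with entries `x_h ^ k`, mapping amplitudes to data. -/
def nodeMat {p : ℕ} (x : Fin p → ℂ) : Matrix (Fin (2 * p)) (Fin p) ℂ :=
  Matrix.of fun k h => x h ^ (k : ℕ)

lemma nodeMat_mulVec {p : ℕ} (x γ : Fin p → ℂ) (k : Fin (2 * p)) :
    (nodeMat x *ᵥ γ) k = ∑ h, γ h * x h ^ (k : ℕ) := by
  simp [nodeMat, Matrix.mulVec, dotProduct, mul_comm]

lemma matX_eq {p : ℕ} (j : Fin p) (ζ : {h : Fin p // h ≠ j} → ℂ) (z : ℂ) :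
    matX j ζ z = (nodeMat (nodes j ζ z))ᴴ := by
  ext h k
  simp [matX, nodeMat]

/-- The first `p` of the `2p` rows already form an invertible Vandermonde matrix. -/
lemma nodeMat_injective {p : ℕ} {x : Fin p → ℂ} (hx : Function.Injective x) :
    Function.Injective (nodeMat x).mulVec := by
  rw [← Matrix.coe_mulVecLin, injective_iff_map_eq_zero]
  intro γ hγ
  refine Matrix.eq_zero_of_forall_pow_sum_mul_pow_eq_zero hx fun i => ?_
  have := congrFun hγ ⟨i, by omega⟩
  simpa [nodeMat_mulVec] using this

/-- The Gram matrix of the nodes. -/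
def gram {p : ℕ} (x : Fin p → ℂ) : Matrix (Fin p) (Fin p) ℂ := (nodeMat x)ᴴ * nodeMat x

lemma gram_posDef {p : ℕ} {x : Fin p → ℂ} (hx : Function.Injective x) : (gram x).PosDef :=
  Matrix.PosDef.conjTranspose_mul_self _ (nodeMat_injective hx)

lemma gram_isUnit_det {p : ℕ} {x : Fin p → ℂ} (hx : Function.Injective x) :
    IsUnit (gram x).det :=
  (Matrix.isUnit_iff_isUnit_det _).1 (gram_posDef hx).isUnit

/-- The least squares amplitudes for given nodes. -/
def ampl {p : ℕ} (s : Fin (2 * p) → ℂ) (x : Fin p → ℂ) : Fin p → ℂ :=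
  (gram x)⁻¹ *ᵥ ((nodeMat x)ᴴ *ᵥ s)

/-- The squared distance between the data and the moments of amplitudes `γ` at nodes `x`. -/
def misfit {p : ℕ} (s : Fin (2 * p) → ℂ) (x γ : Fin p → ℂ) : ℝ :=
  ∑ k : Fin (2 * p), ‖∑ h, γ h * x h ^ (k : ℕ) - s k‖ ^ 2

lemma gram_mulVec_ampl {p : ℕ} (s : Fin (2 * p) → ℂ) {x : Fin p → ℂ} (hx : Function.Injective x) :
    gram x *ᵥ ampl s x = (nodeMat x)ᴴ *ᵥ s := by
  rw [ampl, Matrix.mulVec_mulVec, Matrix.mul_nonsing_inv _ (gram_isUnit_det hx),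
    Matrix.one_mulVec]

lemma sum_norm_sq_eq {ι : Type*} [Fintype ι] (v : ι → ℂ) :
    ∑ k, ‖v k‖ ^ 2 = (star v ⬝ᵥ v).re := by
  simp [dotProduct, ← Complex.normSq_apply, Complex.normSq_eq_norm_sq]

lemma misfit_eq {p : ℕ} (s : Fin (2 * p) → ℂ) (x γ : Fin p → ℂ) :
    misfit s x γ = (star (nodeMat x *ᵥ γ - s) ⬝ᵥ (nodeMat x *ᵥ γ - s)).re := by
  rw [← sum_norm_sq_eq]
  simp [misfit, nodeMat_mulVec]

lemma star_nodeMat_mulVec_dotProduct {p : ℕ} (x γ : Fin p → ℂ) (v : Fin (2 * p) → ℂ) :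
    star (nodeMat x *ᵥ γ) ⬝ᵥ v = star γ ⬝ᵥ ((nodeMat x)ᴴ *ᵥ v) := by
  rw [Matrix.star_mulVec, Matrix.dotProduct_mulVec]

/-- These are the normal equations: the residual is orthogonal to everything the nodes can fit. -/
lemma nodeMat_conjTranspose_residual {p : ℕ} (s : Fin (2 * p) → ℂ) {x : Fin p → ℂ}
    (hx : Function.Injective x) : (nodeMat x)ᴴ *ᵥ (nodeMat x *ᵥ ampl s x - s) = 0 := by
  rw [Matrix.mulVec_sub, Matrix.mulVec_mulVec]
  exact sub_eq_zero.2 (gram_mulVec_ampl s hx)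

lemma misfit_zero_eq {p : ℕ} (x η : Fin p → ℂ) :
    misfit 0 x η = (star η ⬝ᵥ (gram x *ᵥ η)).re := by
  rw [misfit_eq, sub_zero, star_nodeMat_mulVec_dotProduct, Matrix.mulVec_mulVec, gram]

lemma misfit_zero_eq_realForm {p : ℕ} (x η : Fin p → ℂ) :
    misfit 0 x η = realVec η ⬝ᵥ (realForm (gram x) *ᵥ realVec η) := by
  rw [misfit_zero_eq, realForm_mulVec, realVec_dotProduct]

/-- Pythagoras for the least squares amplitudes. -/
lemma misfit_ampl_add {p : ℕ} (s : Fin (2 * p) → ℂ) {x : Fin p → ℂ}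
    (hx : Function.Injective x) (η : Fin p → ℂ) :
    misfit s x (ampl s x + η) = misfit s x (ampl s x) + misfit 0 x η := by
  have h0 := nodeMat_conjTranspose_residual s hx
  have h1 : star (nodeMat x *ᵥ η) ⬝ᵥ (nodeMat x *ᵥ ampl s x - s) = 0 := by
    rw [star_nodeMat_mulVec_dotProduct, h0, dotProduct_zero]
  have h2 : star (nodeMat x *ᵥ ampl s x - s) ⬝ᵥ (nodeMat x *ᵥ η) = 0 := by
    rw [dotProduct_comm, ← star_star (nodeMat x *ᵥ η), Matrix.star_dotProduct_star,
      dotProduct_comm, h1, star_zero]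
  have h3 : nodeMat x *ᵥ (ampl s x + η) - s
      = (nodeMat x *ᵥ ampl s x - s) + nodeMat x *ᵥ η := by
    rw [Matrix.mulVec_add]; abel
  rw [misfit_eq, misfit_eq, misfit_eq, h3, star_add, add_dotProduct, dotProduct_add,
    dotProduct_add, h1, h2, sub_zero]
  simp

lemma misfit_nonneg {p : ℕ} (s : Fin (2 * p) → ℂ) (x γ : Fin p → ℂ) : 0 ≤ misfit s x γ := by
  unfold misfit; positivity

lemma misfit_ampl_le {p : ℕ} (s : Fin (2 * p) → ℂ) {x : Fin p → ℂ}
    (hx : Function.Injective x) (γ : Fin p → ℂ) :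
    misfit s x (ampl s x) ≤ misfit s x γ := by
  have := misfit_ampl_add s hx (γ - ampl s x)
  rw [add_sub_cancel] at this
  linarith [misfit_nonneg 0 x (γ - ampl s x)]

/-- `nu` pairs `s` with the residual. By orthogonality the fitted part of `s` contributes nothing,
so this is the squared norm of the residual. -/
lemma nu_eq_misfit {p : ℕ} (s : Fin (2 * p) → ℂ) (j : Fin p) (ζ : {h : Fin p // h ≠ j} → ℂ)
    (z : ℂ) (hx : Function.Injective (nodes j ζ z)) :
    nu s j ζ z = misfit s (nodes j ζ z) (ampl s (nodes j ζ z)) := by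
  set x := nodes j ζ z
  have h0 := nodeMat_conjTranspose_residual s hx
  have h1 : nu s j ζ z = -(star s ⬝ᵥ (nodeMat x *ᵥ ampl s x - s)).re := by
    rw [nu, matQ, matX_eq, Matrix.conjTranspose_conjTranspose, ampl, gram, Matrix.sub_mulVec,
      Matrix.one_mulVec, ← Matrix.mulVec_mulVec, ← Matrix.mulVec_mulVec, ← Complex.neg_re,
      ← dotProduct_neg, neg_sub]
  rw [misfit_eq, star_sub, sub_dotProduct, star_nodeMat_mulVec_dotProduct, h0, dotProduct_zero,
    zero_sub, Complex.neg_re, h1]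

/-! ### The amplitude factor of the density -/

lemma matQ_eq {p : ℕ} (j : Fin p) (ζ : {h : Fin p // h ≠ j} → ℂ) (z : ℂ) :
    matQ j ζ z = gram (nodes j ζ z) := by
  rw [matQ, matX_eq, Matrix.conjTranspose_conjTranspose, gram]

lemma realQ_eq {p : ℕ} (j : Fin p) (ζ : {h : Fin p // h ≠ j} → ℂ) (z : ℂ) :
    realQ j ζ z = realForm (gram (nodes j ζ z)) := by
  rw [realQ, matQ_eq, realForm]

/-- Since `q` is `Q` applied to the least squares amplitudes, the adjugate maps it to `D` times
them. Each of the `p` factors contains this vector twice, whence the power `2p`, and `A_i` picks out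
the modulus of one amplitude. -/
lemma beta0_eq {p : ℕ} (s : Fin (2 * p) → ℂ) (j : Fin p) (ζ : {h : Fin p // h ≠ j} → ℂ)
    (z : ℂ) (hx : Function.Injective (nodes j ζ z)) :
    beta0 s j ζ z = detD j ζ z ^ (2 * p) * ∏ i, ‖ampl s (nodes j ζ z) i‖ ^ 2 := by
  have hq : realq s j ζ z = realForm (gram (nodes j ζ z)) *ᵥ realVec (ampl s (nodes j ζ z)) := by
    rw [realForm_mulVec, gram_mulVec_ampl s hx, realq, vecq, matX_eq]; rfl
  have hadj : (realQ j ζ z).adjugate *ᵥ realq s j ζ z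
      = detD j ζ z • realVec (ampl s (nodes j ζ z)) := by
    rw [hq, realQ_eq, Matrix.mulVec_mulVec, Matrix.adjugate_mul, ← realQ_eq, detD,
      Matrix.smul_mulVec, Matrix.one_mulVec]
  have hT : (realQ j ζ z).adjugateᵀ = (realQ j ζ z).adjugate := by
    rw [Matrix.adjugate_transpose, realQ_eq, realForm_transpose (gram_posDef hx).1]
  have hA : ∀ (i : Fin p) (v : Fin p → ℂ),
      realVec v ⬝ᵥ (matA i *ᵥ realVec v) = ‖v i‖ ^ 2 := by
    intro i v
    rw [← Complex.normSq_eq_norm_sq, Complex.normSq_apply]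
    simp [matA, realVec, Fintype.sum_sum_type, dotProduct,
      Matrix.mulVec, Matrix.single_apply, Finset.sum_ite_eq, ite_and]
  have hpow : detD j ζ z ^ (2 * p) = ∏ _i : Fin p, detD j ζ z ^ 2 := by
    rw [Finset.prod_const, Finset.card_univ, Fintype.card_fin, pow_mul]
  rw [beta0, hpow, ← Finset.prod_mul_distrib]
  refine Finset.prod_congr rfl fun i _ => ?_
  rw [← Matrix.mulVec_mulVec, ← Matrix.mulVec_mulVec, hadj, Matrix.dotProduct_mulVec,
    ← Matrix.mulVec_transpose, hT, hadj, Matrix.mulVec_smul, smul_dotProduct, dotProduct_smul,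
    hA, smul_eq_mul, smul_eq_mul]
  ring

lemma detD_pos {p : ℕ} (j : Fin p) (ζ : {h : Fin p // h ≠ j} → ℂ)
    (z : ℂ) (hx : Function.Injective (nodes j ζ z)) : 0 < detD j ζ z := by
  rw [detD, realQ_eq]
  exact (realForm_posDef (gram_posDef hx)).det_pos

lemma funK_eq {p : ℕ} (s : Fin (2 * p) → ℂ) (j : Fin p) (ζ : {h : Fin p // h ≠ j} → ℂ)
    (z : ℂ) (hx : Function.Injective (nodes j ζ z)) :
    funK s j ζ z = 1 / Real.pi ^ p * (∏ i, ‖ampl s (nodes j ζ z) i‖ ^ 2) *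
      ‖vander j ζ z‖ ^ 8 / √(detD j ζ z) := by
  have hD := detD_pos j ζ z hx
  have : detD j ζ z ^ ((2 * p : ℝ) + 1 / 2) = detD j ζ z ^ (2 * p) * √(detD j ζ z) := by
    rw [Real.rpow_add hD, Real.sqrt_eq_rpow]
    congr 1
    exact_mod_cast Real.rpow_natCast _ (2 * p)
  rw [funK, beta0_eq s j ζ z hx, this]
  field_simp


/-! ### Polynomial functionals of the data -/

/-- The sum of the absolute values of the coefficients. -/
def coeffNorm (f : Polynomial ℂ) : ℝ := f.sum fun _ a => ‖a‖

lemma coeffNorm_eq {f : Polynomial ℂ} {n : ℕ} (hn : f.natDegree < n) :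
    coeffNorm f = ∑ k ∈ Finset.range n, ‖f.coeff k‖ :=
  f.sum_over_range' (by simp) n hn

lemma coeffNorm_nonneg (f : Polynomial ℂ) : 0 ≤ coeffNorm f := by
  rw [coeffNorm_eq (Nat.lt_succ_self _)]; positivity

lemma coeffNorm_X_pow (m : ℕ) : coeffNorm (Polynomial.X ^ m) = 1 := by
  rw [coeffNorm, ← Polynomial.monomial_one_right_eq_X_pow, Polynomial.sum_monomial_index] <;> simp

lemma coeffNorm_mul_X_sub_C_le (f : Polynomial ℂ) (a : ℂ) :
    coeffNorm (f * (Polynomial.X - Polynomial.C a)) ≤ coeffNorm f * (1 + ‖a‖) := by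
  have h1 : (f * (Polynomial.X - Polynomial.C a)).natDegree < f.natDegree + 1 + 1 := by
    refine Nat.lt_succ_of_le (Polynomial.natDegree_mul_le.trans ?_)
    rw [Polynomial.natDegree_X_sub_C]
  rw [coeffNorm_eq h1, Finset.sum_range_succ']
  have h2 : coeffNorm f = ∑ k ∈ Finset.range (f.natDegree + 1), ‖f.coeff k‖ :=
    coeffNorm_eq (Nat.lt_succ_self _)
  have h3 : coeffNorm f = ∑ k ∈ Finset.range (f.natDegree + 1), ‖f.coeff (k + 1)‖
      + ‖f.coeff 0‖ := by
    rw [← Finset.sum_range_succ' (fun k => ‖f.coeff k‖)]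
    exact coeffNorm_eq (by omega)
  have h4 : ∀ k, ‖(f * (Polynomial.X - Polynomial.C a)).coeff (k + 1)‖
      ≤ ‖f.coeff k‖ + ‖f.coeff (k + 1)‖ * ‖a‖ := fun k => by
    rw [Polynomial.coeff_mul_X_sub_C, ← norm_mul]
    exact norm_sub_le _ _
  have h5 : ‖(f * (Polynomial.X - Polynomial.C a)).coeff 0‖ = ‖f.coeff 0‖ * ‖a‖ := by
    simp [Polynomial.mul_coeff_zero]
  calc _ ≤ ∑ k ∈ Finset.range (f.natDegree + 1), (‖f.coeff k‖ + ‖f.coeff (k + 1)‖ * ‖a‖)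
        + ‖f.coeff 0‖ * ‖a‖ := by rw [h5]; gcongr with k _; exact h4 k
    _ = coeffNorm f * (1 + ‖a‖) := by
        rw [Finset.sum_add_distrib, ← h2, ← Finset.sum_mul, mul_add, mul_one, add_assoc,
          ← add_mul, ← h3]

lemma coeffNorm_mul_prod_le {ι : Type*} (f : Polynomial ℂ) (S : Finset ι) (x : ι → ℂ) :
    coeffNorm (f * ∏ k ∈ S, (Polynomial.X - Polynomial.C (x k)))
      ≤ coeffNorm f * ∏ k ∈ S, (1 + ‖x k‖) := by
  classical
  induction S using Finset.induction_on with
  | empty => simp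
  | insert a S ha ih =>
    rw [Finset.prod_insert ha, Finset.prod_insert ha, mul_comm (Polynomial.X - _), ← mul_assoc,
      mul_comm (1 + ‖x a‖), ← mul_assoc]
    exact (coeffNorm_mul_X_sub_C_le _ _).trans (by gcongr)

/-- The `2p` moments determine a functional on polynomials of degree below `2p`, namely weighted
evaluation at the nodes. All lower bounds on the misfit come from a good choice of `f`. -/
lemma sum_coeff_mul_moment {p : ℕ} {f : Polynomial ℂ} (hf : f.natDegree < 2 * p)
    (x γ : Fin p → ℂ) :
    ∑ k : Fin (2 * p), f.coeff k * ∑ h, γ h * x h ^ (k : ℕ) = ∑ h, γ h * f.eval (x h) := by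
  simp_rw [Finset.mul_sum]
  rw [Finset.sum_comm]
  refine Finset.sum_congr rfl fun h _ => ?_
  rw [Polynomial.eval_eq_sum_range' hf, Finset.mul_sum,
    ← Fin.sum_univ_eq_sum_range (fun k => γ h * (f.coeff k * x h ^ k))]
  exact Finset.sum_congr rfl fun k _ => by ring

lemma norm_functional_sub_le {p : ℕ} {f : Polynomial ℂ} (hf : f.natDegree < 2 * p)
    (s : Fin (2 * p) → ℂ) (x γ : Fin p → ℂ) :
    ‖∑ h, γ h * f.eval (x h) - ∑ k : Fin (2 * p), f.coeff k * s k‖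
      ≤ coeffNorm f * √(misfit s x γ) := by
  rw [← sum_coeff_mul_moment hf, ← Finset.sum_sub_distrib, coeffNorm_eq hf,
    ← Fin.sum_univ_eq_sum_range (fun k => ‖f.coeff k‖), Finset.sum_mul]
  refine (norm_sum_le _ _).trans (Finset.sum_le_sum fun k _ => ?_)
  rw [← mul_sub, norm_mul]
  gcongr
  refine Real.le_sqrt_of_sq_le ?_
  exact Finset.single_le_sum (f := fun k : Fin (2 * p) =>
    ‖∑ h, γ h * x h ^ (k : ℕ) - s k‖ ^ 2) (fun _ _ => by positivity) (Finset.mem_univ k)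

/-- The test polynomial vanishes at every node except possibly `x h`, so only `γ h` survives. Its
degree `m + p - 1` stays below `2p` exactly when `m ≤ p`. -/
lemma norm_amplitude_mul_pow_le {p : ℕ} (x γ : Fin p → ℂ) (h : Fin p) {m : ℕ} (hm : m ≤ p) :
    ‖γ h‖ * (‖x h‖ ^ m * ∏ k ∈ Finset.univ.erase h, ‖x h - x k‖)
      ≤ (∏ k ∈ Finset.univ.erase h, (1 + ‖x k‖)) * √(misfit 0 x γ) := by
  set f : Polynomial ℂ := Polynomial.X ^ m *
    ∏ k ∈ Finset.univ.erase h, (Polynomial.X - Polynomial.C (x k))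
  have hp : 0 < p := h.pos
  have hf : f.natDegree < 2 * p := by
    refine lt_of_le_of_lt Polynomial.natDegree_mul_le ?_
    rw [Polynomial.natDegree_X_pow, Polynomial.natDegree_finsetProd_X_sub_C_eq_card]
    rw [Finset.card_erase_of_mem (Finset.mem_univ _), Finset.card_univ, Fintype.card_fin]
    omega
  have h1 := norm_functional_sub_le hf 0 x γ
  have h2 : ∑ k, γ k * f.eval (x k) = γ h * f.eval (x h) := by
    refine Finset.sum_eq_single h (fun k _ hk => ?_) (by simp)
    rw [Polynomial.eval_mul, Polynomial.eval_prod, Finset.prod_eq_zero (i := k)] <;> simp [hk]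
  have h3 : ‖f.eval (x h)‖ = ‖x h‖ ^ m * ∏ k ∈ Finset.univ.erase h, ‖x h - x k‖ := by
    simp [f, Polynomial.eval_prod]
  rw [h2] at h1
  simp only [Pi.zero_apply, mul_zero, Finset.sum_const_zero, sub_zero, norm_mul, h3] at h1
  refine h1.trans ?_
  gcongr
  simpa [coeffNorm_X_pow] using
    coeffNorm_mul_prod_le (Polynomial.X ^ m) (Finset.univ.erase h) x

/-- The amplitudes are controlled by the data, with the decay at large nodes. -/
lemma norm_amplitude_le {p : ℕ} (x γ : Fin p → ℂ) (h : Fin p) :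
    ‖γ h‖ * ((1 + ‖x h‖) ^ p * ∏ k ∈ Finset.univ.erase h, ‖x h - x k‖)
      ≤ 2 ^ p * ((∏ k ∈ Finset.univ.erase h, (1 + ‖x k‖)) * √(misfit 0 x γ)) := by
  -- The exponent `0` serves bounded nodes and the exponent `p` large ones; convexity of `t ↦ t^p`
  -- merges them into `(1 + ‖x h‖)^p`.
  have h0 := norm_amplitude_mul_pow_le x γ h (Nat.zero_le p)
  have h1 := norm_amplitude_mul_pow_le x γ h le_rfl
  have h2 : (1 + ‖x h‖) ^ p ≤ 2 ^ (p - 1) * (1 + ‖x h‖ ^ p) := by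
    simpa using add_pow_le zero_le_one (norm_nonneg (x h)) p
  have hp : (2 : ℝ) ^ p = 2 ^ (p - 1) * 2 := by
    rw [← pow_succ, Nat.sub_add_cancel h.pos]
  calc _ ≤ ‖γ h‖ * (2 ^ (p - 1) * (1 + ‖x h‖ ^ p) *
        ∏ k ∈ Finset.univ.erase h, ‖x h - x k‖) := by gcongr
    _ = 2 ^ (p - 1) * (‖γ h‖ * (‖x h‖ ^ 0 * ∏ k ∈ Finset.univ.erase h, ‖x h - x k‖)
        + ‖γ h‖ * (‖x h‖ ^ p * ∏ k ∈ Finset.univ.erase h, ‖x h - x k‖)) := by ring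
    _ ≤ 2 ^ (p - 1) * ((∏ k ∈ Finset.univ.erase h, (1 + ‖x k‖)) * √(misfit 0 x γ)
        + (∏ k ∈ Finset.univ.erase h, (1 + ‖x k‖)) * √(misfit 0 x γ)) := by gcongr
    _ = _ := by rw [hp]; ring

/-- Nodes far from every true node cannot fit the data. -/
lemma exists_prod_le_misfit {p : ℕ} {ξ c : Fin p → ℂ} (hξ : Function.Injective ξ)
    (hc : ∀ h, c h ≠ 0) :
    ∃ b : ℝ, 0 < b ∧ ∀ (i : Fin p) (x γ : Fin p → ℂ),
      ∏ k, ‖ξ i - x k‖ ≤ b * (∏ k, (1 + ‖x k‖)) * √(misfit (signal p ξ c) x γ) := by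
  have key : ∀ i : Fin p, ∃ b : ℝ, 0 < b ∧ ∀ (x γ : Fin p → ℂ),
      ∏ k, ‖ξ i - x k‖ ≤ b * (∏ k, (1 + ‖x k‖)) * √(misfit (signal p ξ c) x γ) := by
    intro i
    set g : Polynomial ℂ := Lagrange.basis Finset.univ ξ i
    have hg : g.natDegree ≤ p - 1 := by
      refine Polynomial.natDegree_le_of_degree_le ?_
      rw [Lagrange.degree_basis hξ.injOn (Finset.mem_univ i)]
      simp
    refine ⟨(coeffNorm g + 1) / ‖c i‖, by
      have := norm_pos_iff.2 (hc i)
      have := coeffNorm_nonneg g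
      positivity, fun x γ => ?_⟩
    -- The product kills all fitted nodes, and `g` kills all true nodes except `ξ i`. The degree is
    -- at most `(p - 1) + p`, just within the available moments.
    set f : Polynomial ℂ := g * ∏ k, (Polynomial.X - Polynomial.C (x k))
    have hf : f.natDegree < 2 * p := by
      refine lt_of_le_of_lt Polynomial.natDegree_mul_le ?_
      rw [Polynomial.natDegree_finsetProd_X_sub_C_eq_card, Finset.card_univ, Fintype.card_fin]
      have := i.pos
      omega
    have h1 := norm_functional_sub_le hf (signal p ξ c) x γ
    have h2 : ∑ h, γ h * f.eval (x h) = 0 := by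
      refine Finset.sum_eq_zero fun k _ => ?_
      rw [Polynomial.eval_mul, Polynomial.eval_prod,
        Finset.prod_eq_zero (Finset.mem_univ k) (by simp)]
      simp
    have h3 : ∑ k : Fin (2 * p), f.coeff k * signal p ξ c k = c i * ∏ k, (ξ i - x k) := by
      simp only [signal]
      rw [sum_coeff_mul_moment hf, Finset.sum_eq_single i]
      · rw [Polynomial.eval_mul, Lagrange.eval_basis_self hξ.injOn (Finset.mem_univ i),
          Polynomial.eval_prod]
        simp
      · intro k _ hk
        rw [Polynomial.eval_mul, Lagrange.eval_basis_of_ne hk.symm (Finset.mem_univ k)]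
        simp
      · simp
    rw [h2, h3, zero_sub, norm_neg, norm_mul, norm_prod] at h1
    have h4 := coeffNorm_mul_prod_le g Finset.univ x
    have hci := norm_pos_iff.2 (hc i)
    rw [div_mul_eq_mul_div, div_mul_eq_mul_div, le_div_iff₀ hci, mul_comm]
    refine h1.trans ?_
    gcongr
    refine h4.trans ?_
    gcongr
    linarith
  choose b hb hb' using key
  refine ⟨1 + ∑ i, b i, by
    have := Finset.sum_nonneg (fun i (_ : i ∈ Finset.univ) => (hb i).le); linarith,
    fun i x γ => (hb' i x γ).trans ?_⟩
  gcongr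
  have := Finset.single_le_sum (f := b) (fun i _ => (hb i).le) (Finset.mem_univ i)
  linarith

/-! ### The Vandermonde factor -/

/-- The product of all differences. -/
lemma norm_vander_sq {p : ℕ} (x : Fin p → ℂ) :
    ‖∏ r, ∏ h ∈ Finset.Ioi r, (x r - x h)‖ ^ 2
      = ∏ h, ∏ k ∈ Finset.univ.erase h, ‖x h - x k‖ := by
  have h1 : ∀ h : Fin p, ∏ k ∈ Finset.univ.erase h, ‖x h - x k‖
      = (∏ k ∈ Finset.Iio h, ‖x h - x k‖) * ∏ k ∈ Finset.Ioi h, ‖x h - x k‖ := by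
    intro h
    rw [← Finset.prod_union]
    · congr 1
      ext k
      simp
    · rw [Finset.disjoint_left]
      intro k hk hk'
      simp only [Finset.mem_Iio, Finset.mem_Ioi] at hk hk'
      exact absurd hk (not_lt.2 hk'.le)
  have h2 : ∏ h, ∏ k ∈ Finset.Iio h, ‖x h - x k‖ = ∏ r, ∏ h ∈ Finset.Ioi r, ‖x r - x h‖ := by
    rw [Finset.prod_comm' (t' := Finset.univ) (s' := fun k => Finset.Ioi k) (by simp)]
    refine Finset.prod_congr rfl fun r _ => Finset.prod_congr rfl fun h _ => norm_sub_rev _ _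
  simp_rw [h1, Finset.prod_mul_distrib, h2, norm_prod, sq]


/-! ### Gaussian integrals -/

/-- `realVec` as a linear equivalence. -/
def realVecEquiv (ι : Type*) : (ι → ℂ) ≃ₗ[ℝ] (ι ⊕ ι → ℝ) where
  toFun := realVec
  invFun y h := ⟨y (.inl h), y (.inr h)⟩
  map_add' v w := by ext i; rcases i with i | i <;> simp [realVec]
  map_smul' a v := by ext i; rcases i with i | i <;> simp [realVec]
  left_inv v := rfl
  right_inv y := by ext i; rcases i with i | i <;> rfl

lemma realVec_dotProduct_self {ι : Type*} [Fintype ι] (v : ι → ℂ) :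
    realVec v ⬝ᵥ realVec v = ∑ i, ‖v i‖ ^ 2 := by
  rw [realVec_dotProduct, sum_norm_sq_eq]

lemma integral_exp_neg_sum_norm_sq (ι : Type*) [Fintype ι] :
    ∫ w : ι → ℂ, Real.exp (-∑ i, ‖w i‖ ^ 2) = Real.pi ^ Fintype.card ι := by
  have h1 : ∫ z : ℂ, Real.exp (-‖z‖ ^ 2) = Real.pi := by
    have := GaussianFourier.integral_rexp_neg_mul_sq_norm (V := ℂ) one_pos
    simpa using this
  have h2 : ∀ w : ι → ℂ, Real.exp (-∑ i, ‖w i‖ ^ 2) = ∏ i, Real.exp (-‖w i‖ ^ 2) := fun w => by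
    rw [← Finset.sum_neg_distrib, Real.exp_sum]
  simp_rw [h2]
  rw [MeasureTheory.integral_fintype_prod_volume_eq_pow (fun z : ℂ => Real.exp (-‖z‖ ^ 2)), h1]

open scoped MatrixOrder in
/-- The Gaussian integral of a positive definite real quadratic form on `ℂ^ι`. -/
lemma integral_exp_neg_quadratic {ι : Type*} [Fintype ι] [DecidableEq ι]
    {M : Matrix (ι ⊕ ι) (ι ⊕ ι) ℝ} (hM : M.PosDef) :
    ∫ w : ι → ℂ, Real.exp (-(realVec w ⬝ᵥ (M *ᵥ realVec w)))
      = Real.pi ^ Fintype.card ι / √M.det := by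
  -- With `M = RᵀR`, the linear substitution by `R` in real coordinates reduces to the standard
  -- Gaussian, and its Jacobian is `|det R| = √(det M)`.
  obtain ⟨R, hR⟩ := CStarAlgebra.nonneg_iff_eq_star_mul_self.mp hM.posSemidef.nonneg
  rw [Matrix.star_eq_conjTranspose, Matrix.conjTranspose_eq_transpose_of_trivial] at hR
  have hdet : M.det = R.det ^ 2 := by
    rw [hR, Matrix.det_mul, Matrix.det_transpose, sq]
  have hR0 : R.det ≠ 0 := fun h => by
    have := hM.det_pos
    rw [hdet, h] at this
    norm_num at this
  set e := realVecEquiv ι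
  set T : (ι → ℂ) →ₗ[ℝ] (ι → ℂ) :=
    (e.symm : (ι ⊕ ι → ℝ) →ₗ[ℝ] (ι → ℂ)) ∘ₗ (Matrix.toLin' R ∘ₗ (e : (ι → ℂ) →ₗ[ℝ] _)) with hT
  have hTdet : LinearMap.det T = R.det := by
    have := LinearMap.det_conj (Matrix.toLin' R) e.symm
    rw [LinearMap.det_toLin', LinearEquiv.symm_symm] at this
    rw [← this, hT]
  have h1 : ∀ w : ι → ℂ, realVec w ⬝ᵥ (M *ᵥ realVec w) = ∑ i, ‖T w i‖ ^ 2 := fun w => by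
    have : realVec (T w) = R *ᵥ realVec w := e.apply_symm_apply _
    rw [← realVec_dotProduct_self, this, hR, ← Matrix.mulVec_mulVec, Matrix.dotProduct_mulVec,
      Matrix.vecMul_transpose]
  simp_rw [h1]
  have h2 := MeasureTheory.Measure.map_linearMap_addHaar_eq_smul_addHaar
    (μ := (MeasureTheory.volume : MeasureTheory.Measure (ι → ℂ))) (f := T) (by rwa [hTdet])
  have h3 : ∫ w : ι → ℂ, Real.exp (-∑ i, ‖T w i‖ ^ 2)
      = ∫ w, Real.exp (-∑ i, ‖w i‖ ^ 2) ∂(MeasureTheory.Measure.map T MeasureTheory.volume) := by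
    rw [MeasureTheory.integral_map]
    · exact (LinearMap.continuous_of_finiteDimensional T).measurable.aemeasurable
    · exact Continuous.aestronglyMeasurable (by fun_prop)
  rw [h3, h2, MeasureTheory.integral_smul_measure, integral_exp_neg_sum_norm_sq, hTdet,
    ENNReal.toReal_ofReal (abs_nonneg _), hdet, Real.sqrt_sq_eq_abs, smul_eq_mul, abs_inv]
  ring

lemma exists_pow_mul_exp_neg_le (M : ℕ) {b : ℝ} (hb : 0 < b) :
    ∃ C : ℝ, 0 < C ∧ ∀ t : ℝ, 0 ≤ t → (1 + t) ^ M * Real.exp (-(b * t ^ 2)) ≤ C := by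
  have h1 : Filter.Tendsto (fun t : ℝ => (1 + t) ^ M * Real.exp (-(b * t ^ 2))) Filter.atTop
      (𝓝 0) := by
    have h2 : Filter.Tendsto (fun t : ℝ => t ^ M * Real.exp (-(1 * t))) Filter.atTop (𝓝 0) := by
      simpa using Real.tendsto_pow_mul_exp_neg_atTop_nhds_zero M
    have h3 : Filter.Tendsto (fun t : ℝ => Real.exp 1 * ((1 + t) ^ M * Real.exp (-(1 * (1 + t)))))
        Filter.atTop (𝓝 (Real.exp 1 * 0)) :=
      (h2.comp (Filter.tendsto_atTop_add_const_left _ 1 Filter.tendsto_id)).const_mul _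
    rw [mul_zero] at h3
    refine squeeze_zero' ?_ ?_ h3
    · filter_upwards [Filter.eventually_ge_atTop 0] with t ht
      positivity
    · filter_upwards [Filter.eventually_ge_atTop 0, Filter.eventually_ge_atTop (1 / b)]
        with t ht htb
      have : t ≤ b * t ^ 2 := by
        rw [div_le_iff₀ hb] at htb
        nlinarith
      calc (1 + t) ^ M * Real.exp (-(b * t ^ 2)) ≤ (1 + t) ^ M * Real.exp (-t) := by gcongr
        _ = Real.exp 1 * ((1 + t) ^ M * Real.exp (-(1 * (1 + t)))) := by
          rw [show -(1 * (1 + t)) = -t - 1 by ring, Real.exp_sub]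
          field_simp
  obtain ⟨T, hT⟩ := Filter.eventually_atTop.1 (h1.eventually (gt_mem_nhds one_pos))
  have hT0 : (1 : ℝ) ≤ 1 + max T 0 := by linarith [le_max_right T 0]
  refine ⟨(1 + max T 0) ^ M, by positivity, fun t ht => ?_⟩
  rcases le_total t (max T 0) with h | h
  · calc (1 + t) ^ M * Real.exp (-(b * t ^ 2)) ≤ (1 + max T 0) ^ M * 1 := by
          gcongr
          exact Real.exp_le_one_iff.2 (by nlinarith [mul_nonneg hb.le (sq_nonneg t)])
      _ = _ := mul_one _
  · exact ((hT t ((le_max_left _ _).trans h)).le).trans (one_le_pow₀ hT0)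

lemma integrable_one_add_norm_pow_mul_exp {E : Type*} [NormedAddCommGroup E] [NormedSpace ℝ E]
    [FiniteDimensional ℝ E] [MeasurableSpace E] [BorelSpace E] (μ : MeasureTheory.Measure E)
    [μ.IsAddHaarMeasure] (M : ℕ) {b : ℝ} (hb : 0 < b) :
    MeasureTheory.Integrable (fun x : E => (1 + ‖x‖) ^ M * Real.exp (-(b * ‖x‖ ^ 2))) μ := by
  set d := Module.finrank ℝ E + 1
  obtain ⟨C, hC, h⟩ := exists_pow_mul_exp_neg_le (M + d) hb
  have h1 : MeasureTheory.Integrable (fun x : E => (1 + ‖x‖) ^ (-(d : ℝ))) μ :=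
    integrable_one_add_norm (by simp [d])
  refine (h1.const_mul C).mono' (Continuous.aestronglyMeasurable (by fun_prop)) ?_
  refine Filter.Eventually.of_forall fun x => ?_
  rw [Real.norm_of_nonneg (by positivity), Real.rpow_neg (by positivity), Real.rpow_natCast,
    ← div_eq_mul_inv, le_div_iff₀ (by positivity)]
  refine le_trans (le_of_eq ?_) (h ‖x‖ (norm_nonneg x))
  rw [pow_add]; ring

/-! ### The Laplace method -/

open MeasureTheory Filter in
-- After the substitution `x = x₀ + σ w`, the quadratic lower bound gives a Gaussian majorant
-- independent of `σ`, and dominated convergence applies. The factor `g` may depend on `σ`, because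
-- here it is itself the integral over the amplitudes.
lemma tendsto_laplace {E : Type*} [NormedAddCommGroup E] [NormedSpace ℝ E]
    [FiniteDimensional ℝ E] [MeasurableSpace E] [BorelSpace E] (μ : Measure E)
    [μ.IsAddHaarMeasure] {D : Set E} (hD : MeasurableSet D) {x₀ : E} (hx₀ : D ∈ 𝓝 x₀)
    {f q : E → ℝ} {m : ℝ} (hm : 0 < m) (hf : ∀ x ∈ D, m * ‖x - x₀‖ ^ 2 ≤ f x - f x₀)
    (hq : ∀ w, Tendsto (fun σ : ℝ => (f (x₀ + σ • w) - f x₀) / σ ^ 2) (𝓝[>] 0) (𝓝 (q w)))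
    {g : ℝ → E → ℝ} {L C : ℝ} (hgC : ∀ᶠ σ in 𝓝[>] (0 : ℝ), ∀ x ∈ D, |g σ x| ≤ C)
    (hg : Tendsto (fun a : ℝ × E => g a.1 a.2) (𝓝[>] 0 ×ˢ 𝓝 x₀) (𝓝 L))
    (hmeas : ∀ᶠ σ in 𝓝[>] (0 : ℝ),
      Measurable (D.indicator fun x => g σ x * Real.exp (-(f x - f x₀) / σ ^ 2))) :
    Tendsto (fun σ : ℝ => (σ ^ Module.finrank ℝ E)⁻¹ *
        ∫ x in D, g σ x * Real.exp (-(f x - f x₀) / σ ^ 2) ∂μ) (𝓝[>] 0)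
      (𝓝 (L * ∫ w, Real.exp (-q w) ∂μ)) := by
  set F : ℝ → E → ℝ := fun σ => D.indicator fun x => g σ x * Real.exp (-(f x - f x₀) / σ ^ 2)
  have h1 : ∀ᶠ σ in 𝓝[>] (0 : ℝ), ∫ w, F σ (x₀ + σ • w) ∂μ = (σ ^ Module.finrank ℝ E)⁻¹ *
        ∫ x in D, g σ x * Real.exp (-(f x - f x₀) / σ ^ 2) ∂μ := by
    filter_upwards [self_mem_nhdsWithin] with σ hσ
    rw [Measure.integral_comp_smul_of_nonneg μ (fun y => F σ (x₀ + y)) σ (hR := (le_of_lt hσ)),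
      integral_add_left_eq_self, integral_indicator hD, smul_eq_mul]
  refine Tendsto.congr' h1 ?_
  rw [← integral_const_mul]
  have hline : ∀ w : E, Tendsto (fun σ : ℝ => x₀ + σ • w) (𝓝[>] 0) (𝓝 x₀) := fun w => by
    have : Tendsto (fun σ : ℝ => x₀ + σ • w) (𝓝 0) (𝓝 (x₀ + (0 : ℝ) • w)) :=
      Continuous.tendsto (by fun_prop) 0
    rw [zero_smul, add_zero] at this
    exact this.mono_left nhdsWithin_le_nhds
  refine tendsto_integral_filter_of_dominated_convergence
    (fun w => C * ((1 + ‖w‖) ^ 0 * Real.exp (-(m * ‖w‖ ^ 2)))) ?_ ?_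
    ((integrable_one_add_norm_pow_mul_exp μ 0 hm).const_mul C) ?_
  · filter_upwards [hmeas] with σ hσ
    exact (hσ.comp (by fun_prop : Measurable fun w : E => x₀ + σ • w)).aestronglyMeasurable
  · filter_upwards [hgC, self_mem_nhdsWithin] with σ hσ hσ0
    have hσ0 : (0 : ℝ) < σ := hσ0
    refine Eventually.of_forall fun w => ?_
    have hC : 0 ≤ C := (abs_nonneg _).trans (hσ x₀ (mem_of_mem_nhds hx₀))
    by_cases hw : x₀ + σ • w ∈ D
    · simp only [F, Set.indicator_of_mem hw]
      rw [norm_mul, Real.norm_eq_abs, Real.norm_eq_abs, Real.abs_exp, pow_zero, one_mul]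
      refine mul_le_mul (hσ _ hw) (Real.exp_le_exp.2 ?_) (Real.exp_nonneg _) hC
      have := hf _ hw
      rw [add_sub_cancel_left, norm_smul, Real.norm_of_nonneg hσ0.le, mul_pow] at this
      rw [neg_div, neg_le_neg_iff, le_div_iff₀ (by positivity)]
      linarith
    · simp only [F, Set.indicator_of_notMem hw, norm_zero]
      positivity
  · refine Eventually.of_forall fun w => ?_
    have h2 : Tendsto (fun σ : ℝ => g σ (x₀ + σ • w) *
        Real.exp (-((f (x₀ + σ • w) - f x₀) / σ ^ 2))) (𝓝[>] 0) (𝓝 (L * Real.exp (-q w))) := by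
      refine Tendsto.mul ?_ ((Real.continuous_exp.tendsto _).comp (hq w).neg)
      exact hg.comp (tendsto_id.prodMk (hline w))
    refine h2.congr' ?_
    filter_upwards [(hline w) hx₀] with σ hσ
    simp only [F]
    rw [Set.indicator_of_mem (show x₀ + σ • w ∈ D from hσ), neg_div]

/-! ### Second order expansion -/

lemma exists_taylor_two {E : Type*} [NormedAddCommGroup E] [NormedSpace ℝ E] {f : E → ℝ}
    {U : Set E} (hU : IsOpen U) (hUc : Convex ℝ U) (hf : ContDiffOn ℝ 2 f U) {x v : E}
    (hx : x ∈ U) (hxv : x + v ∈ U) (h0 : fderiv ℝ f x = 0) :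
    ∃ θ ∈ Set.Ioo (0 : ℝ) 1, f (x + v) - f x = fderiv ℝ (fderiv ℝ f) (x + θ • v) v v / 2 := by
  have hmem : ∀ t ∈ Set.Icc (0 : ℝ) 1, x + t • v ∈ U := fun t ht => by
    have := hUc.add_smul_sub_mem hx hxv ht
    simpa using this
  have hline : ∀ t : ℝ, HasDerivAt (fun t : ℝ => x + t • v) v t := fun t => by
    simpa using ((hasDerivAt_id t).smul_const v).const_add x
  have hd1 : ∀ t ∈ Set.Icc (0 : ℝ) 1,
      HasDerivAt (fun t : ℝ => f (x + t • v)) (fderiv ℝ f (x + t • v) v) t := fun t ht => by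
    have hc := hf.contDiffAt (hU.mem_nhds (hmem t ht))
    exact (hc.differentiableAt (by norm_num)).hasFDerivAt.comp_hasDerivAt t (hline t)
  have hd2 : ∀ t ∈ Set.Icc (0 : ℝ) 1, HasDerivAt (fun t : ℝ => fderiv ℝ f (x + t • v) v)
      (fderiv ℝ (fderiv ℝ f) (x + t • v) v v) t := fun t ht => by
    have hc := hf.contDiffAt (hU.mem_nhds (hmem t ht))
    have hc' : ContDiffAt ℝ 1 (fderiv ℝ f) (x + t • v) := hc.fderiv_right (by norm_num)
    have := (hc'.differentiableAt (by norm_num)).hasFDerivAt.comp_hasDerivAt t (hline t)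
    simpa using this.clm_apply (hasDerivAt_const t v)
  -- Cauchy's mean value theorem against `t²` gives `f'(η) / (2η)` along the line; the ordinary mean
  -- value theorem on `[0, η]` turns it into a second derivative.
  obtain ⟨η, hη, h1⟩ := exists_ratio_hasDerivAt_eq_ratio_slope (fun t : ℝ => f (x + t • v))
    (fun t => fderiv ℝ f (x + t • v) v) zero_lt_one
    (fun t ht => (hd1 t ht).continuousAt.continuousWithinAt)
    (fun t ht => hd1 t (Set.Ioo_subset_Icc_self ht)) (fun t : ℝ => t ^ 2) (fun t => 2 * t)
    (by fun_prop) (fun t _ => by simpa using hasDerivAt_pow 2 t)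
  obtain ⟨θ, hθ, h2⟩ := exists_hasDerivAt_eq_slope (fun t : ℝ => fderiv ℝ f (x + t • v) v)
    (fun t => fderiv ℝ (fderiv ℝ f) (x + t • v) v v) hη.1
    (fun t ht => (hd2 t ⟨ht.1, ht.2.trans hη.2.le⟩).continuousAt.continuousWithinAt)
    (fun t ht => hd2 t ⟨ht.1.le, ht.2.le.trans hη.2.le⟩)
  refine ⟨θ, ⟨hθ.1, hθ.2.trans hη.2⟩, ?_⟩
  have hη0 := hη.1.ne'
  simp only [zero_smul, add_zero, h0, zero_apply, sub_zero] at h2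
  simp only [zero_smul, add_zero, one_smul] at h1
  rw [h2]
  field_simp
  linarith


/-! ### Families of minima -/

lemma tendsto_taylor_two {E : Type*} [NormedAddCommGroup E] [NormedSpace ℝ E] {f : E → ℝ}
    {U : Set E} (hU : IsOpen U) (hUc : Convex ℝ U) (hf : ContDiffOn ℝ 2 f U) {x : E}
    (hx : x ∈ U) (h0 : fderiv ℝ f x = 0) (v : E) :
    Filter.Tendsto (fun σ : ℝ => (f (x + σ • v) - f x) / σ ^ 2) (𝓝[>] 0)
      (𝓝 (fderiv ℝ (fderiv ℝ f) x v v / 2)) := by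
  have hcont : ContinuousAt (fun y => fderiv ℝ (fderiv ℝ f) y v v / 2) x := by
    have h1 : ContDiffAt ℝ 1 (fderiv ℝ f) x :=
      (hf.contDiffAt (hU.mem_nhds hx)).fderiv_right (by norm_num)
    have h2 : ContDiffAt ℝ 0 (fderiv ℝ (fderiv ℝ f)) x := h1.fderiv_right (by norm_num)
    have h3 := h2.continuousAt
    exact ((h3.clm_apply continuousAt_const).clm_apply continuousAt_const).div_const 2
  have hline : Filter.Tendsto (fun σ : ℝ => x + σ • v) (𝓝[>] 0) (𝓝 x) := by
    have : Filter.Tendsto (fun σ : ℝ => x + σ • v) (𝓝 0) (𝓝 (x + (0 : ℝ) • v)) :=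
      Continuous.tendsto (by fun_prop) 0
    rw [zero_smul, add_zero] at this
    exact this.mono_left nhdsWithin_le_nhds
  -- The point `θ` is chosen for every `σ`, with the dummy value `0` where the expansion is
  -- unavailable, so that it is a total function bounded by `1`.
  have hex : ∀ σ : ℝ, ∃ θ ∈ Set.Icc (0 : ℝ) 1, 0 < σ → x + σ • v ∈ U →
      (f (x + σ • v) - f x) / σ ^ 2 = fderiv ℝ (fderiv ℝ f) (x + (θ * σ) • v) v v / 2 := by
    intro σ
    by_cases h : 0 < σ ∧ x + σ • v ∈ U
    · obtain ⟨θ, hθ, h1⟩ := exists_taylor_two hU hUc hf hx h.2 h0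
      refine ⟨θ, Set.Ioo_subset_Icc_self hθ, fun hσ _ => ?_⟩
      rw [h1, smul_smul]
      simp only [map_smul, smul_eq_mul, smul_apply]
      field_simp
    · exact ⟨0, ⟨le_rfl, zero_le_one⟩, fun h1 h2 => absurd ⟨h1, h2⟩ h⟩
  choose θ hθ hθ' using hex
  have hθσ : Filter.Tendsto (fun σ : ℝ => x + (θ σ * σ) • v) (𝓝[>] 0) (𝓝 x) := by
    have h1 : Filter.Tendsto (fun σ : ℝ => θ σ * σ) (𝓝[>] 0) (𝓝 0) := by
      refine squeeze_zero' (g := fun σ => σ) ?_ ?_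
        (tendsto_nhdsWithin_of_tendsto_nhds Filter.tendsto_id)
      · filter_upwards [self_mem_nhdsWithin] with σ hσ
        exact mul_nonneg (hθ σ).1 (le_of_lt hσ)
      · filter_upwards [self_mem_nhdsWithin] with σ hσ
        exact mul_le_of_le_one_left (le_of_lt hσ) (hθ σ).2
    have := (h1.smul_const v).const_add x
    rwa [zero_smul, add_zero] at this
  refine (hcont.tendsto.comp hθσ).congr' ?_
  filter_upwards [self_mem_nhdsWithin, hline (hU.mem_nhds hx)] with σ hσ hσU
  exact (hθ' σ hσ hσU).symm

lemma contDiffAt_partial_fderiv {W Z G : Type*} [NormedAddCommGroup W] [NormedSpace ℝ W]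
    [NormedAddCommGroup Z] [NormedSpace ℝ Z] [NormedAddCommGroup G] [NormedSpace ℝ G]
    {F : W → Z → G} {a : W × Z} {m n : WithTop ℕ∞}
    (hF : ContDiffAt ℝ n (fun a : W × Z => F a.1 a.2) a) (hmn : m + 1 ≤ n) :
    ContDiffAt ℝ m (fun a : W × Z => fderiv ℝ (fun w => F w a.2) a.1) a := by
  refine ContDiffAt.fderiv (f := fun (a : W × Z) w => F w a.2) (g := Prod.fst) (n := n)
    ?_ contDiffAt_fst hmn
  exact ContDiffAt.comp (g := fun a : W × Z => F a.1 a.2)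
    (f := fun b : (W × Z) × W => (b.2, b.1.2)) (a, a.1) hF (by fun_prop)

/-- The growth bound makes the Hessian at the base point at least `2c`, hence at least `c` nearby by
continuity. Minima over a compact ball are then interior, nondegenerate and unique, and compactness
makes them continuous in `z`. The parameter `δ` keeps the minimum value below a threshold fixed
after `ε`. -/
lemma exists_minimizer_family {W Z : Type*} [NormedAddCommGroup W] [NormedSpace ℝ W]
    [FiniteDimensional ℝ W] [NormedAddCommGroup Z] [NormedSpace ℝ Z]
    {F : W → Z → ℝ} {w₀ : W} {z₀ : Z} (hF : ContDiffAt ℝ 2 (fun a : W × Z => F a.1 a.2) (w₀, z₀))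
    {c : ℝ} (hc : 0 < c) (hlow : ∀ᶠ a : W × Z in 𝓝 (w₀, z₀), c * ‖a.1 - w₀‖ ^ 2 ≤ F a.1 a.2)
    (h0 : F w₀ z₀ = 0) :
    ∃ r : ℝ, 0 < r ∧ ∀ ε : ℝ, 0 < ε → ε ≤ r → ∀ δ : ℝ, 0 < δ →
      ∃ ρ : ℝ, 0 < ρ ∧ ρ ≤ ε ∧ ∃ m : Z → W, ContinuousOn m (Metric.ball z₀ ρ) ∧ m z₀ = w₀ ∧
        ∀ z ∈ Metric.ball z₀ ρ, m z ∈ Metric.ball w₀ ε ∧ F (m z) z < δ ∧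
          ContDiffOn ℝ 2 (fun w => F w z) (Metric.ball w₀ ε) ∧
          fderiv ℝ (fun w => F w z) (m z) = 0 ∧
          (∀ w ∈ Metric.ball w₀ ε, c / 2 * ‖w - m z‖ ^ 2 ≤ F w z - F (m z) z) ∧
          ∀ v, c * ‖v‖ ^ 2 ≤ fderiv ℝ (fderiv ℝ fun w => F w z) (m z) v v := by
  set H : W × Z → (W →L[ℝ] W →L[ℝ] ℝ) := fun a => fderiv ℝ (fderiv ℝ fun w => F w a.2) a.1
  have hHcont : ContinuousAt H (w₀, z₀) := by
    have h1 : ContDiffAt ℝ 1 (fun a : W × Z => fderiv ℝ (fun w => F w a.2) a.1) (w₀, z₀) :=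
      contDiffAt_partial_fderiv hF (by norm_num)
    have h2 : ContDiffAt ℝ 0 (fun a : W × Z =>
        fderiv ℝ (fun w => fderiv ℝ (fun w => F w a.2) w) a.1) (w₀, z₀) :=
      contDiffAt_partial_fderiv (F := fun w z => fderiv ℝ (fun w => F w z) w) h1 (by norm_num)
    exact h2.continuousAt
  have hnear : ∀ᶠ a : W × Z in 𝓝 (w₀, z₀), ContDiffAt ℝ 2 (fun a : W × Z => F a.1 a.2) a ∧
      c * ‖a.1 - w₀‖ ^ 2 ≤ F a.1 a.2 ∧ ‖H a - H (w₀, z₀)‖ < c := by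
    refine (hF.eventually (by simp)).and (hlow.and ?_)
    have h1 := (Metric.tendsto_nhds (α := W →L[ℝ] W →L[ℝ] ℝ)).1 hHcont.tendsto c hc
    exact h1.mono fun a ha => (dist_eq_norm (H a) (H (w₀, z₀))).symm.trans_lt ha
  obtain ⟨r, hr, hball⟩ := Metric.eventually_nhds_iff_ball.1 hnear
  have hgood : ∀ {ε : ℝ}, ε ≤ r → ∀ w ∈ Metric.ball w₀ ε, ∀ z ∈ Metric.ball z₀ r,
      ContDiffAt ℝ 2 (fun a : W × Z => F a.1 a.2) (w, z) ∧
      c * ‖w - w₀‖ ^ 2 ≤ F w z ∧ ‖H (w, z) - H (w₀, z₀)‖ < c := fun hε w hw z hz => by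
    refine hball (w, z) ?_
    rw [← ball_prod_same]
    exact ⟨Metric.ball_subset_ball hε hw, hz⟩
  have hsmooth : ∀ {ε : ℝ}, ε ≤ r → ∀ z ∈ Metric.ball z₀ r,
      ContDiffOn ℝ 2 (fun w => F w z) (Metric.ball w₀ ε) := fun hε z hz w hw => by
    have := (hgood hε w hw z hz).1
    exact (ContDiffAt.comp (g := fun a : W × Z => F a.1 a.2) (f := fun w : W => (w, z)) w this
      (by fun_prop)).contDiffWithinAt
  have hz₀r : z₀ ∈ Metric.ball z₀ r := Metric.mem_ball_self hr
  have hw₀r : w₀ ∈ Metric.ball w₀ r := Metric.mem_ball_self hr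
  have hcrit : ∀ z ∈ Metric.ball z₀ r, ∀ ε ≤ r, ∀ w ∈ Metric.ball w₀ ε,
      (∀ w' ∈ Metric.ball w₀ ε, F w z ≤ F w' z) → fderiv ℝ (fun w => F w z) w = 0 := by
    intro z hz ε hε w hw hmin
    refine IsLocalMin.fderiv_eq_zero ?_
    filter_upwards [Metric.isOpen_ball.mem_nhds hw] with w' hw' using hmin w' hw'
  have hH0 : ∀ v, 2 * c * ‖v‖ ^ 2 ≤ H (w₀, z₀) v v := by
    intro v
    have h1 := hcrit z₀ hz₀r r le_rfl w₀ hw₀r fun w' hw' => by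
      rw [h0]; exact (by positivity : (0 : ℝ) ≤ _).trans (hgood le_rfl w' hw' z₀ hz₀r).2.1
    have h2 := tendsto_taylor_two Metric.isOpen_ball (convex_ball w₀ r)
      (hsmooth le_rfl z₀ hz₀r) hw₀r h1 v
    have h3 : c * ‖v‖ ^ 2 ≤ H (w₀, z₀) v v / 2 := by
      refine ge_of_tendsto h2 ?_
      have hline : Filter.Tendsto (fun σ : ℝ => w₀ + σ • v) (𝓝[>] 0) (𝓝 w₀) := by
        have : Filter.Tendsto (fun σ : ℝ => w₀ + σ • v) (𝓝 0) (𝓝 (w₀ + (0 : ℝ) • v)) :=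
          Continuous.tendsto (by fun_prop) 0
        rw [zero_smul, add_zero] at this
        exact this.mono_left nhdsWithin_le_nhds
      filter_upwards [self_mem_nhdsWithin, hline (Metric.ball_mem_nhds w₀ hr)] with σ hσ hσr
      have hσ0 : (0 : ℝ) < σ := hσ
      have := (hgood le_rfl _ hσr z₀ hz₀r).2.1
      rw [add_sub_cancel_left, norm_smul, Real.norm_of_nonneg hσ0.le, mul_pow] at this
      rw [h0, sub_zero, le_div_iff₀ (by positivity)]
      linarith
    linarith
  have hHpos : ∀ w ∈ Metric.ball w₀ r, ∀ z ∈ Metric.ball z₀ r, ∀ v,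
      c * ‖v‖ ^ 2 ≤ H (w, z) v v := by
    intro w hw z hz v
    have h1 := (hgood le_rfl w hw z hz).2.2
    have h2 := ContinuousLinearMap.le_opNorm₂ (H (w, z) - H (w₀, z₀)) v v
    have h3 : ‖(H (w, z) - H (w₀, z₀)) v v‖ ≤ c * ‖v‖ ^ 2 := by
      refine h2.trans ?_
      rw [mul_assoc, ← sq]
      gcongr
    have h4 : (H (w, z) - H (w₀, z₀)) v v = H (w, z) v v - H (w₀, z₀) v v := rfl
    rw [h4, Real.norm_eq_abs] at h3
    have := (abs_le.1 h3).1
    linarith [hH0 v]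
  refine ⟨r, hr, fun ε hε hεr δ hδ => ?_⟩
  have hFz : ContinuousAt (fun z => F w₀ z) z₀ :=
    ContinuousAt.comp (g := fun a : W × Z => F a.1 a.2) (f := fun z => (w₀, z))
      hF.continuousAt (by fun_prop)
  -- Outside the ball of radius `ε / 2` the growth bound gives at least `c (ε / 2)²`, which exceeds
  -- the value at the centre; so the minimum over the half ball is the minimum over the whole ball.
  have hsmall : ∀ᶠ z in 𝓝 z₀, F w₀ z < min δ (c * (ε / 2) ^ 2) := by
    refine hFz.tendsto.eventually (gt_mem_nhds ?_)
    rw [h0]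
    positivity
  obtain ⟨ρ', hρ', hsmall'⟩ := Metric.eventually_nhds_iff_ball.1 hsmall
  set ρ := min ρ' ε
  have hρr : Metric.ball z₀ ρ ⊆ Metric.ball z₀ r :=
    Metric.ball_subset_ball ((min_le_right _ _).trans hεr)
  have hKb : Metric.closedBall w₀ (ε / 2) ⊆ Metric.ball w₀ ε :=
    Metric.closedBall_subset_ball (by linarith)
  have hw₀K : w₀ ∈ Metric.closedBall w₀ (ε / 2) := Metric.mem_closedBall_self (by linarith)
  have hexm : ∀ z ∈ Metric.ball z₀ ρ, ∃ w ∈ Metric.closedBall w₀ (ε / 2),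
      F w z ≤ F w₀ z ∧ ∀ w' ∈ Metric.ball w₀ ε, F w z ≤ F w' z := by
    intro z hz
    obtain ⟨w, hw, hmin⟩ := (isCompact_closedBall w₀ (ε / 2)).exists_isMinOn ⟨w₀, hw₀K⟩
      ((hsmooth hεr z (hρr hz)).continuousOn.mono hKb)
    refine ⟨w, hw, hmin hw₀K, fun w' hw' => ?_⟩
    by_cases hK : w' ∈ Metric.closedBall w₀ (ε / 2)
    · exact hmin hK
    · have h1 : F w z ≤ F w₀ z := hmin hw₀K
      have h2 := hsmall' z (Metric.ball_subset_ball (min_le_left _ _) hz)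
      have h3 := (hgood hεr w' hw' z (hρr hz)).2.1
      rw [Metric.mem_closedBall, dist_eq_norm, not_le] at hK
      have h4 : c * (ε / 2) ^ 2 ≤ c * ‖w' - w₀‖ ^ 2 := by gcongr
      have := h2.trans_le (min_le_right _ _)
      linarith
  choose! m hmK hmle hmmin using hexm
  have hquad : ∀ z ∈ Metric.ball z₀ ρ, fderiv ℝ (fun w => F w z) (m z) = 0 ∧
      ∀ w ∈ Metric.ball w₀ ε, c / 2 * ‖w - m z‖ ^ 2 ≤ F w z - F (m z) z := by
    intro z hz
    have hcr := hcrit z (hρr hz) ε hεr (m z) (hKb (hmK z hz)) (hmmin z hz)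
    refine ⟨hcr, fun w hw => ?_⟩
    obtain ⟨θ, hθ, h1⟩ := exists_taylor_two (v := w - m z) Metric.isOpen_ball
      (convex_ball w₀ ε) (hsmooth hεr z (hρr hz)) (hKb (hmK z hz)) (by simpa using hw) hcr
    rw [add_sub_cancel] at h1
    rw [h1]
    have hmem : m z + θ • (w - m z) ∈ Metric.ball w₀ ε :=
      (convex_ball w₀ ε).add_smul_sub_mem (hKb (hmK z hz)) hw (Set.Ioo_subset_Icc_self hθ)
    have := hHpos _ (Metric.ball_subset_ball hεr hmem) z (hρr hz) (w - m z)
    simp only [H] at this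
    linarith
  have hρ : 0 < ρ := lt_min hρ' hε
  refine ⟨ρ, hρ, min_le_right _ _, m, ?_, ?_, fun z hz => ⟨hKb (hmK z hz), ?_,
    hsmooth hεr z (hρr hz), (hquad z hz).1, (hquad z hz).2,
    hHpos _ (Metric.ball_subset_ball hεr (hKb (hmK z hz))) z (hρr hz)⟩⟩
  · intro z₁ hz₁
    -- Every cluster point of `m` at `z₁` also minimizes `F · z₁`, so quadratic growth identifies it
    -- with `m z₁`.
    refine (isCompact_closedBall w₀ (ε / 2)).tendsto_nhds_of_unique_mapClusterPt
      (eventually_mem_nhdsWithin.mono fun z hz => hmK z hz) fun y hy hcl => ?_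
    obtain ⟨u, hu, huy⟩ := mapClusterPt_iff_ultrafilter.1 hcl
    have huz : Filter.Tendsto id (u : Filter Z) (𝓝 z₁) :=
      hu.trans nhdsWithin_le_nhds
    have hcont : ∀ w ∈ Metric.ball w₀ ε, ContinuousAt (fun a : W × Z => F a.1 a.2) (w, z₁) :=
      fun w hw => (hgood hεr w hw z₁ (hρr hz₁)).1.continuousAt
    have h1 : Filter.Tendsto (fun z => F (m z) z) u (𝓝 (F y z₁)) :=
      (hcont y (hKb hy)).tendsto.comp (huy.prodMk_nhds huz)
    have h2 : Filter.Tendsto (fun z => F (m z₁) z) u (𝓝 (F (m z₁) z₁)) :=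
      (hcont (m z₁) (hKb (hmK z₁ hz₁))).tendsto.comp (tendsto_const_nhds.prodMk_nhds huz)
    have h3 : F y z₁ ≤ F (m z₁) z₁ := by
      refine le_of_tendsto_of_tendsto h1 h2 ?_
      filter_upwards [hu self_mem_nhdsWithin] with z hz
      exact hmmin z hz _ (hKb (hmK z₁ hz₁))
    have h4 := (hquad z₁ hz₁).2 y (hKb hy)
    have h5 : ‖y - m z₁‖ ^ 2 ≤ 0 := by
      by_contra hcon
      have := mul_pos (half_pos hc) (not_le.1 hcon)
      linarith
    exact sub_eq_zero.1 (norm_eq_zero.1 (pow_eq_zero_iff two_ne_zero |>.1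
      (le_antisymm h5 (by positivity))))
  · have hz₀ρ : z₀ ∈ Metric.ball z₀ ρ := Metric.mem_ball_self hρ
    have h1 := (hgood hεr _ (hKb (hmK z₀ hz₀ρ)) z₀ hz₀r).2.1
    have h2 := hmle z₀ hz₀ρ
    have h5 : ‖m z₀ - w₀‖ ^ 2 ≤ 0 := by
      by_contra hcon
      have := mul_pos hc (not_le.1 hcon)
      linarith
    exact sub_eq_zero.1 (norm_eq_zero.1 (pow_eq_zero_iff two_ne_zero |>.1
      (le_antisymm h5 (by positivity))))
  · exact (hmle z hz).trans_lt
      ((hsmall' z (Metric.ball_subset_ball (min_le_left _ _) hz)).trans_le (min_le_left _ _))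


/-! ### Smoothness in the nodes -/

section Smooth

variable {E : Type*} [NormedAddCommGroup E] [NormedSpace ℝ E] {m : WithTop ℕ∞}

lemma contDiffAt_det {n : Type*} [Fintype n] [DecidableEq n] {A : E → Matrix n n ℂ} {a : E}
    (hA : ∀ i j, ContDiffAt ℝ m (fun x => A x i j) a) :
    ContDiffAt ℝ m (fun x => (A x).det) a := by
  simp_rw [Matrix.det_apply]
  refine ContDiffAt.sum fun σ _ => ?_
  exact (contDiffAt_prod fun i _ => hA _ _).const_smul _

lemma contDiffAt_adjugate {n : Type*} [Fintype n] [DecidableEq n] {A : E → Matrix n n ℂ} {a : E}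
    (hA : ∀ i j, ContDiffAt ℝ m (fun x => A x i j) a) (i j : n) :
    ContDiffAt ℝ m (fun x => (A x).adjugate i j) a := by
  simp_rw [Matrix.adjugate_apply]
  refine contDiffAt_det fun k l => ?_
  simp only [Matrix.updateRow_apply]
  split_ifs
  · exact contDiffAt_const
  · exact hA k l

lemma contDiffAt_conj {f : E → ℂ} {a : E} (hf : ContDiffAt ℝ m f a) :
    ContDiffAt ℝ m (fun x => starRingEnd ℂ (f x)) a :=
  Complex.conjCLE.contDiff.contDiffAt.comp a hf

/-- By the adjugate formula, the amplitudes are rational in the nodes and their conjugates, with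
denominator the nonzero Gram determinant. The smoothness is real, not complex. -/
lemma contDiffAt_ampl {p : ℕ} (s : Fin (2 * p) → ℂ) {x : Fin p → ℂ}
    (hx : Function.Injective x) : ContDiffAt ℝ m (ampl s) x := by
  have hcoord : ∀ h : Fin p, ContDiffAt ℝ m (fun y : Fin p → ℂ => y h) x := fun h =>
    contDiffAt_apply ..
  have hgram : ∀ i j, ContDiffAt ℝ m (fun y : Fin p → ℂ => gram y i j) x := fun i j => by
    simp only [gram, nodeMat, Matrix.mul_apply, Matrix.conjTranspose_apply, Matrix.of_apply]
    refine ContDiffAt.sum fun k _ => ContDiffAt.mul ?_ ((hcoord j).pow _)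
    exact contDiffAt_conj ((hcoord i).pow _)
  rw [contDiffAt_pi]
  intro i
  have h1 : ∀ y : Fin p → ℂ, ampl s y i = ∑ l, (gram y).det⁻¹ * (gram y).adjugate i l *
      ∑ k : Fin (2 * p), starRingEnd ℂ (y l ^ (k : ℕ)) * s k := fun y => by
    simp only [ampl, Matrix.inv_def, Matrix.mulVec, dotProduct, Ring.inverse_eq_inv',
      Matrix.smul_apply, smul_eq_mul, nodeMat, Matrix.conjTranspose_apply, Matrix.of_apply]
    rfl
  simp_rw [h1]
  refine ContDiffAt.sum fun l _ => ContDiffAt.mul (ContDiffAt.mul ?_ ?_) ?_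
  · exact (contDiffAt_det hgram).inv (gram_isUnit_det hx).ne_zero
  · exact contDiffAt_adjugate hgram i l
  · exact ContDiffAt.sum fun k _ => (contDiffAt_conj ((hcoord l).pow _)).mul contDiffAt_const

lemma contDiff_misfit {p : ℕ} (s : Fin (2 * p) → ℂ) :
    ContDiff ℝ m (fun a : (Fin p → ℂ) × (Fin p → ℂ) => misfit s a.1 a.2) := by
  unfold misfit
  refine ContDiff.sum fun k _ => ?_
  have h1 : ContDiff ℝ m (fun a : (Fin p → ℂ) × (Fin p → ℂ) =>
      ∑ h, a.2 h * a.1 h ^ (k : ℕ) - s k) := by fun_prop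
  exact h1.norm_sq ℝ

lemma contDiffAt_misfit_ampl {p : ℕ} (s : Fin (2 * p) → ℂ) {x : Fin p → ℂ}
    (hx : Function.Injective x) : ContDiffAt ℝ m (fun x => misfit s x (ampl s x)) x :=
  ContDiffAt.comp (g := fun a : (Fin p → ℂ) × (Fin p → ℂ) => misfit s a.1 a.2)
    (f := fun x => (x, ampl s x)) x (contDiff_misfit s).contDiffAt
    (contDiffAt_id.prodMk (contDiffAt_ampl s hx))

lemma contDiff_nodes {p : ℕ} (j : Fin p) :
    ContDiff ℝ m (fun a : ({h : Fin p // h ≠ j} → ℂ) × ℂ => nodes j a.1 a.2) := by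
  rw [contDiff_pi]
  intro h
  unfold nodes
  split_ifs
  · exact contDiff_snd
  · fun_prop

end Smooth

lemma eventually_injective {ι X : Type*} [Finite ι] [TopologicalSpace X] [T2Space X] {x : ι → X}
    (hx : Function.Injective x) : ∀ᶠ y in 𝓝 x, Function.Injective y := by
  have h : ∀ a : ι × ι, ∀ᶠ y : ι → X in 𝓝 x, y a.1 = y a.2 → a.1 = a.2 := fun a => by
    by_cases hab : a.1 = a.2
    · exact Filter.Eventually.of_forall fun _ _ => hab
    · have h1 : ContinuousAt (fun y : ι → X => y a.1) x := (continuous_apply _).continuousAt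
      have h2 : ContinuousAt (fun y : ι → X => y a.2) x := (continuous_apply _).continuousAt
      filter_upwards [h1.ne_iff_eventually_ne h2 |>.1 (fun h => hab (hx h))] with y hy h
      exact absurd h hy
  filter_upwards [Filter.eventually_all.2 h] with y hy a b hab using hy (a, b) hab

lemma nodes_self {p : ℕ} (j : Fin p) (x : Fin p → ℂ) :
    nodes j (fun h : {h : Fin p // h ≠ j} => x h.1) (x j) = x := by
  ext h
  by_cases hj : h = j <;> simp [nodes, hj]

lemma contDiffAt_nu {p : ℕ} (s : Fin (2 * p) → ℂ) (j : Fin p) {ζ : {h : Fin p // h ≠ j} → ℂ}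
    {z : ℂ} (hx : Function.Injective (nodes j ζ z)) {m : WithTop ℕ∞} :
    ContDiffAt ℝ m (fun a : ({h : Fin p // h ≠ j} → ℂ) × ℂ => nu s j a.1 a.2) (ζ, z) := by
  have h1 : ContDiffAt ℝ m (fun a : ({h : Fin p // h ≠ j} → ℂ) × ℂ =>
      misfit s (nodes j a.1 a.2) (ampl s (nodes j a.1 a.2))) (ζ, z) :=
    ContDiffAt.comp (g := fun x => misfit s x (ampl s x))
      (f := fun a : ({h : Fin p // h ≠ j} → ℂ) × ℂ => nodes j a.1 a.2) (ζ, z)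
      (contDiffAt_misfit_ampl s hx) (contDiff_nodes j).contDiffAt
  have hcont : Filter.Tendsto (fun a : ({h : Fin p // h ≠ j} → ℂ) × ℂ => nodes j a.1 a.2)
      (𝓝 (ζ, z)) (𝓝 (nodes j ζ z)) := (contDiff_nodes (m := 0) j).continuous.tendsto (ζ, z)
  have hinj := hcont.eventually (eventually_injective hx)
  refine h1.congr_of_eventuallyEq ?_
  filter_upwards [hinj] with a ha using nu_eq_misfit s j a.1 a.2 ha

/-! ### The true nodes -/

lemma misfit_signal {p : ℕ} (ξ c : Fin p → ℂ) : misfit (signal p ξ c) ξ c = 0 := by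
  simp [misfit, signal]

lemma eq_zero_of_misfit_zero {p : ℕ} {x η : Fin p → ℂ} (hx : Function.Injective x)
    (h : misfit 0 x η = 0) : η = 0 := by
  have h1 : nodeMat x *ᵥ η = 0 := by
    ext k
    rw [misfit, Finset.sum_eq_zero_iff_of_nonneg (fun _ _ => by positivity)] at h
    simpa [nodeMat_mulVec] using h k (Finset.mem_univ k)
  exact nodeMat_injective hx (by rw [h1, Matrix.mulVec_zero])

lemma misfit_ampl_signal {p : ℕ} {ξ c : Fin p → ℂ} (hξ : Function.Injective ξ) :
    misfit (signal p ξ c) ξ (ampl (signal p ξ c) ξ) = 0 :=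
  le_antisymm ((misfit_ampl_le _ hξ c).trans_eq (misfit_signal ξ c)) (misfit_nonneg _ _ _)

lemma ampl_signal {p : ℕ} {ξ c : Fin p → ℂ} (hξ : Function.Injective ξ) :
    ampl (signal p ξ c) ξ = c := by
  have h1 := misfit_ampl_add (signal p ξ c) hξ (c - ampl (signal p ξ c) ξ)
  rw [add_sub_cancel, misfit_signal, misfit_ampl_signal hξ, zero_add] at h1
  exact (sub_eq_zero.1 (eq_zero_of_misfit_zero hξ h1.symm)).symm

lemma exists_pos_eventually_le {ι X : Type*} [Finite ι] [TopologicalSpace X] {w : ι → X → ℝ}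
    {x₀ : X} (hw : ∀ i, ContinuousAt (w i) x₀) (hpos : ∀ i, 0 < w i x₀) :
    ∃ τ : ℝ, 0 < τ ∧ ∀ᶠ x in 𝓝 x₀, ∀ i, τ ≤ w i x := by
  obtain ⟨τ, hτ, hτw⟩ : ∃ τ : ℝ, 0 < τ ∧ ∀ i, τ < w i x₀ := by
    rcases isEmpty_or_nonempty ι with h | h
    · exact ⟨1, one_pos, fun i => h.elim i⟩
    · obtain ⟨i, hi⟩ := Finite.exists_min (fun i => w i x₀)
      exact ⟨w i x₀ / 2, half_pos (hpos i), fun k => by linarith [hi k, hpos i]⟩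
  exact ⟨τ, hτ, Filter.eventually_all.2 fun i =>
    ((hw i).eventually (lt_mem_nhds (hτw i))).mono fun _ h => h.le⟩

/-- In the product bound for `ξ i`, the factors with `k ≠ i` stay away from zero near `ξ`; dividing
by them leaves `‖x i - ξ i‖`. -/
lemma exists_eventually_le_misfit {p : ℕ} {ξ c : Fin p → ℂ} (hξ : Function.Injective ξ)
    (hc : ∀ h, c h ≠ 0) :
    ∃ κ : ℝ, 0 < κ ∧ ∀ᶠ x in 𝓝 ξ, ∀ i γ, κ * ‖x i - ξ i‖ ^ 2 ≤ misfit (signal p ξ c) x γ := by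
  obtain ⟨b, hb, hbound⟩ := exists_prod_le_misfit hξ hc
  set w : Fin p → (Fin p → ℂ) → ℝ := fun i x =>
    (∏ k ∈ Finset.univ.erase i, ‖ξ i - x k‖) / (b * ∏ k, (1 + ‖x k‖)) with hw
  have hden : ∀ x : Fin p → ℂ, 0 < b * ∏ k, (1 + ‖x k‖) := fun x =>
    mul_pos hb (Finset.prod_pos fun k _ => by positivity)
  have hpos : ∀ i, 0 < w i ξ := fun i => by
    refine div_pos (Finset.prod_pos fun k hk => ?_) (hden ξ)
    rw [norm_pos_iff, sub_ne_zero]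
    exact fun h => Finset.ne_of_mem_erase hk (hξ h).symm
  have hcont : ∀ i, ContinuousAt (w i) ξ := fun i =>
    ContinuousAt.div
      (Continuous.continuousAt (continuous_finsetProd _ fun k _ => by fun_prop))
      (Continuous.continuousAt (continuous_const.mul (continuous_finsetProd _ fun k _ =>
        by fun_prop))) (hden ξ).ne'
  have hle : ∀ i x γ, w i x * ‖x i - ξ i‖ ≤ √(misfit (signal p ξ c) x γ) := fun i x γ => by
    have := hbound i x γ
    rw [← Finset.mul_prod_erase _ _ (Finset.mem_univ i)] at this
    simp only [hw]
    rw [div_mul_eq_mul_div, div_le_iff₀ (hden x), norm_sub_rev, mul_comm]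
    linarith
  obtain ⟨τ, hτ, hτw⟩ := exists_pos_eventually_le hcont hpos
  refine ⟨τ ^ 2, by positivity, ?_⟩
  filter_upwards [hτw] with x hx i γ
  have h1 : τ * ‖x i - ξ i‖ ≤ √(misfit (signal p ξ c) x γ) :=
    le_trans (by gcongr; exact hx i) (hle i x γ)
  rw [← mul_pow]
  exact (Real.le_sqrt (by positivity) (misfit_nonneg _ _ _)).1 h1

/-- A small misfit forces the nodes to be close to a permutation of the true nodes. -/
lemma exists_perm_of_misfit_lt {p : ℕ} {ξ c : Fin p → ℂ} (hξ : Function.Injective ξ)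
    (hc : ∀ h, c h ≠ 0) {ε : ℝ} (hε : 0 < ε) (hsep : ∀ h k, h ≠ k → 2 * ε ≤ ‖ξ h - ξ k‖) :
    ∃ δ : ℝ, 0 < δ ∧ ∀ x γ, misfit (signal p ξ c) x γ < δ →
      ∃ π : Equiv.Perm (Fin p), ∀ i, ‖x (π i) - ξ i‖ < ε := by
  obtain ⟨b, hb, hbound⟩ := exists_prod_le_misfit hξ hc
  obtain ⟨R, hR⟩ : ∃ R : ℝ, ∀ i, ‖ξ i‖ ≤ R :=
    ⟨∑ i, ‖ξ i‖, fun i => Finset.single_le_sum (f := fun i => ‖ξ i‖)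
      (fun _ _ => norm_nonneg _) (Finset.mem_univ i)⟩
  rcases isEmpty_or_nonempty (Fin p) with h | ⟨⟨i₀⟩⟩
  · exact ⟨1, one_pos, fun x γ _ => ⟨1, fun i => h.elim i⟩⟩
  have hR0 : 0 ≤ R := (norm_nonneg _).trans (hR i₀)
  -- With this `θ`, a node at distance at least `ε` from `ξ i` is at distance at least `θ (1 + ‖x
  -- k‖)`, however large it is. If all nodes were that far, the product bound would give `θ^p ≤ b
  -- √misfit`, which the choice of `δ` excludes.
  set θ := ε / (1 + R + ε)
  have hθ : 0 < θ := by positivity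
  refine ⟨(θ ^ p / b) ^ 2, by positivity, fun x γ hlt => ?_⟩
  have hsqrt : b * √(misfit (signal p ξ c) x γ) < θ ^ p := by
    rw [← lt_div_iff₀' hb]
    exact (Real.sqrt_lt' (by positivity)).2 hlt
  have hex : ∀ i, ∃ k, ‖x k - ξ i‖ < ε := by
    intro i
    by_contra! hcon
    have h1 : ∀ k, θ * (1 + ‖x k‖) ≤ ‖ξ i - x k‖ := fun k => by
      have h2 := hcon k
      rw [norm_sub_rev] at h2
      have h3 : ‖x k‖ ≤ R + ‖ξ i - x k‖ := by
        have h4 := norm_sub_norm_le (x k) (ξ i)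
        rw [norm_sub_rev] at h4
        linarith [hR i]
      rw [div_mul_eq_mul_div, div_le_iff₀ (by positivity)]
      nlinarith
    have h2 : ∏ k, (θ * (1 + ‖x k‖)) ≤ ∏ k, ‖ξ i - x k‖ :=
      Finset.prod_le_prod (fun k _ => by positivity) fun k _ => h1 k
    rw [Finset.prod_mul_distrib, Finset.prod_const, Finset.card_univ, Fintype.card_fin] at h2
    have h3 : 0 < ∏ k, (1 + ‖x k‖) := Finset.prod_pos fun k _ => by positivity
    have h4 := h2.trans (hbound i x γ)
    nlinarith
  choose f hf using hex
  have hinj : Function.Injective f := fun a b' hab => by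
    by_contra hne
    have h1 := hsep a b' hne
    have h2 := hf a
    have h3 := hf b'
    rw [← hab] at h3
    have h4 : ‖ξ a - ξ b'‖ ≤ ‖x (f a) - ξ a‖ + ‖x (f a) - ξ b'‖ := by
      rw [norm_sub_rev (x (f a)) (ξ a)]
      simpa using norm_add_le (ξ a - x (f a)) (x (f a) - ξ b')
    linarith
  exact ⟨Equiv.ofBijective f (Finite.injective_iff_bijective.1 hinj), fun i => hf i⟩


/-! ### The integral over the amplitudes -/

/-- The Vandermonde product of all nodes. -/
def vand {p : ℕ} (x : Fin p → ℂ) : ℂ := ∏ r, ∏ h ∈ Finset.Ioi r, (x r - x h)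

/-- The integral over the amplitudes for given nodes. -/
def amplitudeIntegral {p : ℕ} (s : Fin (2 * p) → ℂ) (x : Fin p → ℂ) (σ : ℝ) : ℝ :=
  ∫ γ : Fin p → ℂ, ‖vand x‖ ^ 8 * (∏ h, ‖γ h‖ ^ 2) * Real.exp (-(1 / σ ^ 2) * misfit s x γ)

/-- The rescaled integral over the amplitudes, centred at the least squares amplitudes. -/
def reducedIntegral {p : ℕ} (s : Fin (2 * p) → ℂ) (σ : ℝ) (x : Fin p → ℂ) : ℝ :=
  ‖vand x‖ ^ 8 *
    ∫ η : Fin p → ℂ, (∏ h, ‖ampl s x h + σ * η h‖ ^ 2) * Real.exp (-misfit 0 x η)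

lemma norm_jacobianC_sq {p : ℕ} (j : Fin p) (ζ : {h : Fin p // h ≠ j} → ℂ) (z : ℂ)
    (γ : Fin p → ℂ) :
    ‖jacobianC j ζ z γ‖ ^ 2 = ‖vand (nodes j ζ z)‖ ^ 8 * ∏ h, ‖γ h‖ ^ 2 := by
  rw [jacobianC, norm_mul, norm_mul, norm_pow, norm_neg, norm_one, one_pow, one_mul, norm_prod,
    norm_pow, mul_pow, ← pow_mul, ← Finset.prod_pow, mul_comm]
  rfl

lemma densityIntegral_eq {p : ℕ} (s : Fin (2 * p) → ℂ) (j : Fin p)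
    (D : Set ({h : Fin p // h ≠ j} → ℂ)) (z : ℂ) (σ : ℝ) :
    densityIntegral s j D z σ = 1 / (Real.pi * σ ^ 2) ^ (2 * p) *
      ∫ ζ in D, amplitudeIntegral s (nodes j ζ z) σ := by
  simp only [densityIntegral, norm_jacobianC_sq]
  rfl

lemma finrank_pi_complex (ι : Type*) [Fintype ι] :
    Module.finrank ℝ (ι → ℂ) = 2 * Fintype.card ι := by
  rw [Module.finrank_pi_fintype]
  simp [Complex.finrank_real_complex, mul_comm]

lemma misfit_zero_smul {p : ℕ} (x η : Fin p → ℂ) (σ : ℝ) :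
    misfit 0 x (σ • η) = σ ^ 2 * misfit 0 x η := by
  simp only [misfit, Pi.zero_apply, sub_zero, Pi.smul_apply, smul_mul_assoc, ← Finset.smul_sum,
    norm_smul, mul_pow, ← Finset.mul_sum, Real.norm_eq_abs, sq_abs]

/-- This is the substitution `γ = ampl + σ η` followed by Pythagoras; `2p` is the real dimension of
the amplitude space. -/
lemma amplitudeIntegral_eq {p : ℕ} (s : Fin (2 * p) → ℂ) {x : Fin p → ℂ}
    (hx : Function.Injective x) {σ : ℝ} (hσ : 0 < σ) :
    amplitudeIntegral s x σ = σ ^ (2 * p) *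
      (reducedIntegral s σ x * Real.exp (-(misfit s x (ampl s x)) / σ ^ 2)) := by
  set F : (Fin p → ℂ) → ℝ := fun γ =>
    ‖vand x‖ ^ 8 * (∏ h, ‖γ h‖ ^ 2) * Real.exp (-(1 / σ ^ 2) * misfit s x γ)
  have h1 : ∀ η : Fin p → ℂ, F (ampl s x + σ • η) =
      (‖vand x‖ ^ 8 * Real.exp (-(misfit s x (ampl s x)) / σ ^ 2)) *
        ((∏ h, ‖ampl s x h + σ * η h‖ ^ 2) * Real.exp (-misfit 0 x η)) := fun η => by
    simp only [F, misfit_ampl_add s hx, misfit_zero_smul]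
    have : -(1 / σ ^ 2) * (misfit s x (ampl s x) + σ ^ 2 * misfit 0 x η)
        = -(misfit s x (ampl s x)) / σ ^ 2 + -misfit 0 x η := by
      field_simp
      ring
    rw [this, Real.exp_add]
    simp only [Pi.add_apply, Pi.smul_apply, Complex.real_smul]
    ring
  have h2 := MeasureTheory.Measure.integral_comp_smul_of_nonneg
    (MeasureTheory.volume : MeasureTheory.Measure (Fin p → ℂ)) (fun y => F (ampl s x + y)) σ
    (hR := hσ.le)
  rw [MeasureTheory.integral_add_left_eq_self F, finrank_pi_complex, Fintype.card_fin,
    smul_eq_mul] at h2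
  simp_rw [h1] at h2
  rw [MeasureTheory.integral_const_mul] at h2
  have h3 : amplitudeIntegral s x σ = ∫ γ, F γ := rfl
  rw [h3, reducedIntegral]
  have hσ' : σ ^ (2 * p) ≠ 0 := by positivity
  rw [eq_inv_mul_iff_mul_eq₀ hσ'] at h2
  rw [← h2]
  ring

lemma continuous_vand {p : ℕ} : Continuous (vand (p := p)) :=
  continuous_finsetProd _ fun _ _ => continuous_finsetProd _ fun _ _ => by fun_prop

lemma continuous_misfit {p : ℕ} (s : Fin (2 * p) → ℂ) :
    Continuous (fun a : (Fin p → ℂ) × (Fin p → ℂ) => misfit s a.1 a.2) :=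
  (contDiff_misfit (m := 0) s).continuous

lemma exists_eventually_le_misfit_zero {p : ℕ} {x₀ : Fin p → ℂ} (hx : Function.Injective x₀) :
    ∃ b : ℝ, 0 < b ∧ ∀ᶠ x in 𝓝 x₀, ∀ η, b * ‖η‖ ^ 2 ≤ misfit 0 x η := by
  set w : Fin p → (Fin p → ℂ) → ℝ := fun h x =>
    ((1 + ‖x h‖) ^ p * ∏ k ∈ Finset.univ.erase h, ‖x h - x k‖) /
      (2 ^ p * ∏ k ∈ Finset.univ.erase h, (1 + ‖x k‖)) with hw
  have hden : ∀ (h : Fin p) (x : Fin p → ℂ),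
      0 < (2 : ℝ) ^ p * ∏ k ∈ Finset.univ.erase h, (1 + ‖x k‖) := fun h x =>
    mul_pos (by positivity) (Finset.prod_pos fun k _ => by positivity)
  have hpos : ∀ h, 0 < w h x₀ := fun h => by
    refine div_pos (mul_pos (by positivity) (Finset.prod_pos fun k hk => ?_)) (hden h x₀)
    rw [norm_pos_iff, sub_ne_zero]
    exact fun h => Finset.ne_of_mem_erase hk (hx h).symm
  have hcont : ∀ h, ContinuousAt (w h) x₀ := fun h =>
    ContinuousAt.div
      (Continuous.continuousAt (Continuous.mul (by fun_prop)
        (continuous_finsetProd _ fun k _ => by fun_prop)))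
      (Continuous.continuousAt (continuous_const.mul (continuous_finsetProd _ fun k _ =>
        by fun_prop))) (hden h x₀).ne'
  obtain ⟨τ, hτ, hτw⟩ := exists_pos_eventually_le hcont hpos
  refine ⟨τ ^ 2, by positivity, ?_⟩
  filter_upwards [hτw] with x hx η
  rw [← mul_pow, ← Real.le_sqrt (by positivity) (misfit_nonneg _ _ _), ← le_div_iff₀' hτ]
  refine (pi_norm_le_iff_of_nonneg (by positivity)).2 fun h => ?_
  rw [le_div_iff₀' hτ]
  have h1 := norm_amplitude_le x η h
  calc τ * ‖η h‖ ≤ w h x * ‖η h‖ := by gcongr; exact hx h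
    _ ≤ _ := by
      simp only [hw]
      rw [div_mul_eq_mul_div, div_le_iff₀ (hden h x)]
      linarith

/-- The Gram form is coercive uniformly near `x₀`, which gives a Gaussian majorant. Joint continuity
at `σ = 0` provides both the limit and the uniform bound that Laplace's method requires. -/
lemma continuousAt_reducedIntegral {p : ℕ} (s : Fin (2 * p) → ℂ) {x₀ : Fin p → ℂ}
    (hx : Function.Injective x₀) (σ₀ : ℝ) :
    ContinuousAt (fun a : ℝ × (Fin p → ℂ) => reducedIntegral s a.1 a.2) (σ₀, x₀) := by
  unfold reducedIntegral
  refine ContinuousAt.mul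
    ((continuous_vand.comp continuous_snd).norm.pow 8).continuousAt ?_
  obtain ⟨b, hb, hbx⟩ := exists_eventually_le_misfit_zero hx
  have hampl : ContinuousAt (ampl s) x₀ := (contDiffAt_ampl (m := 0) s hx).continuousAt
  have hampl' : ContinuousAt (fun a : ℝ × (Fin p → ℂ) => ampl s a.2) (σ₀, x₀) :=
    ContinuousAt.comp (f := Prod.snd) (x := (σ₀, x₀)) hampl continuousAt_snd
  set R := ‖ampl s x₀‖ + 1 + (|σ₀| + 1)
  refine MeasureTheory.continuousAt_of_dominated
    (bound := fun η => R ^ (2 * p) * ((1 + ‖η‖) ^ (2 * p) * Real.exp (-(b * ‖η‖ ^ 2)))) ?_ ?_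
    ((integrable_one_add_norm_pow_mul_exp _ _ hb).const_mul _) ?_
  · refine Filter.Eventually.of_forall fun a => Continuous.aestronglyMeasurable ?_
    refine Continuous.mul (continuous_finsetProd _ fun h _ => by fun_prop) ?_
    exact Real.continuous_exp.comp
      ((continuous_misfit 0).comp (Continuous.prodMk continuous_const continuous_id)).neg
  · have h1 : ∀ᶠ a : ℝ × (Fin p → ℂ) in 𝓝 (σ₀, x₀), ‖ampl s a.2‖ < ‖ampl s x₀‖ + 1 :=
      hampl'.norm.eventually (gt_mem_nhds (by simp))
    have h2 : ∀ᶠ a : ℝ × (Fin p → ℂ) in 𝓝 (σ₀, x₀), |a.1| < |σ₀| + 1 :=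
      (continuous_fst.abs.continuousAt (x := (σ₀, x₀))).eventually (gt_mem_nhds (by simp))
    filter_upwards [h1, h2, continuousAt_snd.eventually hbx] with a ha1 ha2 ha3
    refine Filter.Eventually.of_forall fun η => ?_
    have h3 : ∀ h, ‖ampl s a.2 h + a.1 * η h‖ ≤ R * (1 + ‖η‖) := fun h => by
      refine (norm_add_le _ _).trans ?_
      rw [norm_mul, Complex.norm_real, Real.norm_eq_abs]
      have h4 := norm_le_pi_norm (ampl s a.2) h
      have h5 : |a.1| * ‖η h‖ ≤ (|σ₀| + 1) * ‖η‖ :=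
        mul_le_mul ha2.le (norm_le_pi_norm η h) (norm_nonneg _) (by positivity)
      have h6 := mul_nonneg (by positivity : 0 ≤ ‖ampl s x₀‖ + 1) (norm_nonneg η)
      have h7 := abs_nonneg σ₀
      simp only [R]
      nlinarith
    rw [Real.norm_of_nonneg (by positivity), ← mul_assoc, ← mul_pow]
    refine mul_le_mul ?_ (Real.exp_le_exp.2 (neg_le_neg (ha3 η))) (Real.exp_nonneg _)
      (by positivity)
    calc ∏ h, ‖ampl s a.2 h + a.1 * η h‖ ^ 2 ≤ ∏ _h : Fin p, (R * (1 + ‖η‖)) ^ 2 :=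
          Finset.prod_le_prod (fun _ _ => by positivity) fun h _ => by gcongr; exact h3 h
      _ = (R * (1 + ‖η‖)) ^ (2 * p) := by
          rw [Finset.prod_const, Finset.card_univ, Fintype.card_fin, pow_mul]
  · refine Filter.Eventually.of_forall fun η => ContinuousAt.mul ?_ ?_
    · have h4 : ∀ h, ContinuousAt (fun a : ℝ × (Fin p → ℂ) => ampl s a.2 h) (σ₀, x₀) :=
        continuousAt_pi.1 hampl'
      refine tendsto_finsetProd _ fun h _ => ?_
      exact ((h4 h).add (by fun_prop)).norm.pow 2
    · refine Continuous.continuousAt (Real.continuous_exp.comp ?_)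
      exact ((continuous_misfit 0).comp (Continuous.prodMk continuous_snd continuous_const)).neg

lemma reducedIntegral_zero {p : ℕ} (s : Fin (2 * p) → ℂ) {x : Fin p → ℂ}
    (hx : Function.Injective x) :
    reducedIntegral s 0 x = ‖vand x‖ ^ 8 * (∏ h, ‖ampl s x h‖ ^ 2) *
      (Real.pi ^ p / √(realForm (gram x)).det) := by
  have h1 := integral_exp_neg_quadratic (realForm_posDef (gram_posDef hx))
  rw [Fintype.card_fin] at h1
  simp_rw [← misfit_zero_eq_realForm] at h1
  rw [← h1, mul_assoc, reducedIntegral]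
  simp only [Complex.ofReal_zero, zero_mul, add_zero]
  rw [MeasureTheory.integral_const_mul]

/-! ### Domination over all nodes -/

lemma integral_norm_sq_mul_exp {a : ℝ} (ha : 0 < a) :
    ∫ z : ℂ, ‖z‖ ^ 2 * Real.exp (-(a * ‖z‖ ^ 2)) = Real.pi / a ^ 2 := by
  have h := Complex.integral_rpow_mul_exp_neg_mul_rpow (p := 2) (q := 2) (b := a) (by norm_num)
    (by norm_num) ha
  have h2 : Real.Gamma ((2 + 2) / 2) = 1 := by
    rw [show ((2 : ℝ) + 2) / 2 = 2 by norm_num]; exact Real.Gamma_two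
  have h3 : a ^ (-(2 + 2) / 2 : ℝ) = (a ^ 2)⁻¹ := by
    rw [show (-(2 + 2) / 2 : ℝ) = -(2 : ℕ) by norm_num, Real.rpow_neg ha.le, Real.rpow_natCast]
  rw [h2, h3] at h
  simp only [Real.rpow_two, neg_mul] at h
  rw [h]
  ring

lemma integrable_norm_sq_mul_exp {a : ℝ} (ha : 0 < a) :
    MeasureTheory.Integrable fun z : ℂ => ‖z‖ ^ 2 * Real.exp (-(a * ‖z‖ ^ 2)) := by
  refine (integrable_one_add_norm_pow_mul_exp MeasureTheory.volume 2 ha).mono'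
    (Continuous.aestronglyMeasurable (by fun_prop)) (Filter.Eventually.of_forall fun z => ?_)
  rw [Real.norm_of_nonneg (by positivity)]
  gcongr
  linarith [norm_nonneg z]

lemma misfit_zero_le {p : ℕ} (s : Fin (2 * p) → ℂ) (x γ : Fin p → ℂ) :
    misfit 0 x γ ≤ 2 * misfit s x γ + 2 * ∑ k, ‖s k‖ ^ 2 := by
  simp only [misfit, Finset.mul_sum, ← Finset.sum_add_distrib]
  refine Finset.sum_le_sum fun k _ => ?_
  have := norm_add_le (∑ h, γ h * x h ^ (k : ℕ) - s k) (s k)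
  rw [sub_add_cancel] at this
  rw [Pi.zero_apply, sub_zero]
  nlinarith [sq_nonneg (‖∑ h, γ h * x h ^ (k : ℕ) - s k‖ - ‖s k‖),
    norm_nonneg (∑ h, γ h * x h ^ (k : ℕ))]

/-- The constants in the bound of the amplitudes by the data. -/
def amplConst {p : ℕ} (x : Fin p → ℂ) (h : Fin p) : ℝ :=
  2 ^ p * (∏ k ∈ Finset.univ.erase h, (1 + ‖x k‖)) /
    ((1 + ‖x h‖) ^ p * ∏ k ∈ Finset.univ.erase h, ‖x h - x k‖)

lemma amplConst_pos {p : ℕ} {x : Fin p → ℂ} (hx : Function.Injective x) (h : Fin p) :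
    0 < amplConst x h := by
  refine div_pos (mul_pos (by positivity) (Finset.prod_pos fun k _ => by positivity))
    (mul_pos (by positivity) (Finset.prod_pos fun k hk => ?_))
  rw [norm_pos_iff, sub_ne_zero]
  exact fun h => Finset.ne_of_mem_erase hk (hx h).symm

lemma norm_vand_sq {p : ℕ} (x : Fin p → ℂ) :
    ‖vand x‖ ^ 2 = ∏ h, ∏ k ∈ Finset.univ.erase h, ‖x h - x k‖ := norm_vander_sq x

lemma norm_vand_pos {p : ℕ} {x : Fin p → ℂ} (hx : Function.Injective x) : 0 < ‖vand x‖ := by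
  refine norm_pos_iff.2 (Finset.prod_ne_zero_iff.2 fun r _ => Finset.prod_ne_zero_iff.2
    fun h hh => sub_ne_zero.2 fun heq => ?_)
  exact (Finset.mem_Ioi.1 hh).ne (hx heq)

lemma vand_eq_zero {p : ℕ} {x : Fin p → ℂ} (hx : ¬ Function.Injective x) : vand x = 0 := by
  simp only [Function.Injective, not_forall] at hx
  obtain ⟨a, b, hab, hne⟩ := hx
  have h1 : ‖vand x‖ ^ 2 = 0 := by
    rw [norm_vand_sq]
    refine Finset.prod_eq_zero (Finset.mem_univ a) (Finset.prod_eq_zero (i := b) ?_ ?_)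
    · simpa using fun h => hne h.symm
    · simp [hab]
  simpa using h1

/-- The product of the constants is `2^(p²) / (∏ (1 + ‖x h‖) · ‖vand x‖²)`, so its fourth power
cancels the Vandermonde factor exactly. What is left decays with exponent `4`, more than the real
dimension `2` of each node. -/
lemma norm_vand_pow_mul_prod_amplConst {p : ℕ} {x : Fin p → ℂ} (hx : Function.Injective x) :
    ‖vand x‖ ^ 8 * ∏ h, amplConst x h ^ 4 = 2 ^ (4 * p * p) * ∏ h, ((1 + ‖x h‖) ^ 4)⁻¹ := by
  have hP : 0 < ∏ h, (1 + ‖x h‖) := Finset.prod_pos fun h _ => by positivity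
  have hV := norm_vand_pos hx
  have h1 : ∀ h, ∏ k ∈ Finset.univ.erase h, (1 + ‖x k‖)
      = (∏ k, (1 + ‖x k‖)) / (1 + ‖x h‖) := fun h => by
    rw [eq_div_iff (by positivity), Finset.prod_erase_mul _ _ (Finset.mem_univ h)]
  have h2 : ∏ h, amplConst x h = 2 ^ (p * p) / ((∏ h, (1 + ‖x h‖)) * ‖vand x‖ ^ 2) := by
    simp only [amplConst, h1]
    rw [Finset.prod_div_distrib, Finset.prod_mul_distrib, Finset.prod_mul_distrib,
      Finset.prod_div_distrib, ← norm_vand_sq, Finset.prod_const, Finset.prod_const,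
      Finset.prod_pow, Finset.card_univ, Fintype.card_fin, ← pow_mul]
    field_simp
  rw [Finset.prod_pow, h2, Finset.prod_inv_distrib, Finset.prod_pow]
  field_simp
  ring

/-- The misfit bounds each amplitude separately; averaging these `p` bounds decouples the amplitudes
and makes the majorant a product of planar Gaussians. -/
lemma exp_neg_misfit_le {p : ℕ} (s : Fin (2 * p) → ℂ) {x : Fin p → ℂ}
    (hx : Function.Injective x) (γ : Fin p → ℂ) :
    Real.exp (-misfit s x γ) ≤ Real.exp (∑ k, ‖s k‖ ^ 2) *
      ∏ h, Real.exp (-(1 / (2 * p * amplConst x h ^ 2) * ‖γ h‖ ^ 2)) := by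
  rw [← Real.exp_sum, ← Real.exp_add, Real.exp_le_exp, Finset.sum_neg_distrib]
  have h1 := misfit_zero_le s x γ
  have h2 : ∑ h, 1 / (2 * p * amplConst x h ^ 2) * ‖γ h‖ ^ 2
      ≤ ∑ _h : Fin p, misfit 0 x γ / (2 * p) := by
    refine Finset.sum_le_sum fun h _ => ?_
    have hp : (0 : ℝ) < p := by exact_mod_cast h.pos
    have hK := amplConst_pos hx h
    have h3 : ‖γ h‖ ≤ amplConst x h * √(misfit 0 x γ) := by
      have h4 := norm_amplitude_le x γ h
      have h5 : 0 < (1 + ‖x h‖) ^ p * ∏ k ∈ Finset.univ.erase h, ‖x h - x k‖ := by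
        refine mul_pos (by positivity) (Finset.prod_pos fun k hk => ?_)
        rw [norm_pos_iff, sub_ne_zero]
        exact fun h => Finset.ne_of_mem_erase hk (hx h).symm
      rw [amplConst, div_mul_eq_mul_div, le_div_iff₀ h5]
      linarith
    have h4 : ‖γ h‖ ^ 2 ≤ amplConst x h ^ 2 * misfit 0 x γ := by
      calc ‖γ h‖ ^ 2 ≤ (amplConst x h * √(misfit 0 x γ)) ^ 2 := by gcongr
        _ = _ := by rw [mul_pow, Real.sq_sqrt (misfit_nonneg _ _ _)]
    rw [div_mul_eq_mul_div, one_mul, div_le_div_iff₀ (by positivity) (by positivity)]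
    nlinarith
  have h3 : ∑ _h : Fin p, misfit 0 x γ / (2 * p) ≤ misfit 0 x γ / 2 := by
    rw [Finset.sum_const, Finset.card_univ, Fintype.card_fin, nsmul_eq_mul]
    rcases Nat.eq_zero_or_pos p with rfl | hp
    · have := misfit_nonneg 0 x γ
      simp only [Nat.cast_zero, zero_mul]
      positivity
    · have : (0 : ℝ) < p := by exact_mod_cast hp
      refine le_of_eq ?_
      field_simp
  linarith

lemma amplitudeIntegral_one_integrand_le {p : ℕ} (s : Fin (2 * p) → ℂ) {x : Fin p → ℂ}
    (hx : Function.Injective x) (γ : Fin p → ℂ) :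
    ‖vand x‖ ^ 8 * (∏ h, ‖γ h‖ ^ 2) * Real.exp (-(1 / 1 ^ 2) * misfit s x γ)
      ≤ ‖vand x‖ ^ 8 * Real.exp (∑ k, ‖s k‖ ^ 2) *
        ∏ h, (‖γ h‖ ^ 2 * Real.exp (-(1 / (2 * p * amplConst x h ^ 2) * ‖γ h‖ ^ 2))) := by
  have h1 := exp_neg_misfit_le s hx γ
  rw [one_pow, div_one, neg_mul, one_mul, Finset.prod_mul_distrib]
  calc _ ≤ ‖vand x‖ ^ 8 * (∏ h, ‖γ h‖ ^ 2) * _ :=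
        mul_le_mul_of_nonneg_left h1 (by positivity)
    _ = _ := by ring

lemma amplRate_pos {p : ℕ} {x : Fin p → ℂ} (hx : Function.Injective x) (h : Fin p) :
    0 < 1 / (2 * p * amplConst x h ^ 2) := by
  have hp : (0 : ℝ) < p := by exact_mod_cast h.pos
  have := amplConst_pos hx h
  positivity

lemma integrable_amplitude_majorant {p : ℕ} {x : Fin p → ℂ} (hx : Function.Injective x) :
    MeasureTheory.Integrable fun γ : Fin p → ℂ =>
      ∏ h, (‖γ h‖ ^ 2 * Real.exp (-(1 / (2 * p * amplConst x h ^ 2) * ‖γ h‖ ^ 2))) :=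
  MeasureTheory.Integrable.fintype_prod (f := fun h (z : ℂ) =>
    ‖z‖ ^ 2 * Real.exp (-(1 / (2 * p * amplConst x h ^ 2) * ‖z‖ ^ 2)))
    fun h => integrable_norm_sq_mul_exp (amplRate_pos hx h)

lemma continuous_amplitude_integrand {p : ℕ} (s : Fin (2 * p) → ℂ) (σ : ℝ) :
    Continuous fun a : (Fin p → ℂ) × (Fin p → ℂ) =>
      ‖vand a.1‖ ^ 8 * (∏ h, ‖a.2 h‖ ^ 2) * Real.exp (-(1 / σ ^ 2) * misfit s a.1 a.2) :=
  (((continuous_vand.comp continuous_fst).norm.pow 8).mul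
    (continuous_finsetProd _ fun h _ => by fun_prop)).mul
    (Real.continuous_exp.comp (continuous_const.mul (continuous_misfit s)))

lemma integrable_amplitude_integrand {p : ℕ} (s : Fin (2 * p) → ℂ) (x : Fin p → ℂ) :
    MeasureTheory.Integrable fun γ : Fin p → ℂ =>
      ‖vand x‖ ^ 8 * (∏ h, ‖γ h‖ ^ 2) * Real.exp (-(1 / 1 ^ 2) * misfit s x γ) := by
  by_cases hx : Function.Injective x
  · refine ((integrable_amplitude_majorant hx).const_mul
      (‖vand x‖ ^ 8 * Real.exp (∑ k, ‖s k‖ ^ 2))).mono' ?_ ?_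
    · exact ((continuous_amplitude_integrand s 1).comp
        (Continuous.prodMk continuous_const continuous_id)).aestronglyMeasurable
    · refine Filter.Eventually.of_forall fun γ => ?_
      rw [Real.norm_of_nonneg (by positivity)]
      exact amplitudeIntegral_one_integrand_le s hx γ
  · simp [vand_eq_zero hx]

lemma amplitudeIntegral_one_le {p : ℕ} (s : Fin (2 * p) → ℂ) :
    ∃ C : ℝ, 0 ≤ C ∧ ∀ x, amplitudeIntegral s x 1 ≤ C * ∏ h, ((1 + ‖x h‖) ^ 4)⁻¹ := by
  refine ⟨Real.exp (∑ k, ‖s k‖ ^ 2) * (4 * Real.pi * p ^ 2) ^ p * 2 ^ (4 * p * p),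
    by positivity, fun x => ?_⟩
  by_cases hx : Function.Injective x
  · refine (MeasureTheory.integral_mono (integrable_amplitude_integrand s x)
      ((integrable_amplitude_majorant hx).const_mul _)
      (amplitudeIntegral_one_integrand_le s hx)).trans ?_
    rw [MeasureTheory.integral_const_mul,
      MeasureTheory.integral_fintype_prod_volume_eq_prod (fun h (z : ℂ) =>
        ‖z‖ ^ 2 * Real.exp (-(1 / (2 * p * amplConst x h ^ 2) * ‖z‖ ^ 2)))]
    have h1 : ∀ h, ∫ z : ℂ, ‖z‖ ^ 2 * Real.exp (-(1 / (2 * p * amplConst x h ^ 2) * ‖z‖ ^ 2))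
        = 4 * Real.pi * p ^ 2 * amplConst x h ^ 4 := fun h => by
      rw [integral_norm_sq_mul_exp (amplRate_pos hx h)]
      field_simp
      ring
    simp_rw [h1]
    rw [Finset.prod_mul_distrib, Finset.prod_const, Finset.card_univ, Fintype.card_fin]
    have h2 := norm_vand_pow_mul_prod_amplConst hx
    refine le_of_eq ?_
    calc _ = Real.exp (∑ k, ‖s k‖ ^ 2) * (4 * Real.pi * p ^ 2) ^ p *
          (‖vand x‖ ^ 8 * ∏ h, amplConst x h ^ 4) := by ring
      _ = _ := by rw [h2]; ring
  · rw [amplitudeIntegral, vand_eq_zero hx]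
    simp only [norm_zero, ne_eq, OfNat.ofNat_ne_zero, not_false_eq_true, zero_pow, zero_mul,
      MeasureTheory.integral_zero]
    positivity

lemma amplitudeIntegral_nonneg {p : ℕ} (s : Fin (2 * p) → ℂ) (x : Fin p → ℂ) (σ : ℝ) :
    0 ≤ amplitudeIntegral s x σ :=
  MeasureTheory.integral_nonneg fun γ => by positivity

/-- Split `1/σ²` as `(1/σ² - 1) + 1`: the first part meets the lower bound `δ`, and the second keeps
the convergent integral at `σ = 1`. -/
lemma amplitudeIntegral_le {p : ℕ} (s : Fin (2 * p) → ℂ) {x : Fin p → ℂ} {δ σ : ℝ}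
    (hδ : ∀ γ, δ ≤ misfit s x γ) (hσ : 0 < σ) (hσ1 : σ ≤ 1) :
    amplitudeIntegral s x σ ≤ Real.exp (-(δ * (1 / σ ^ 2 - 1))) * amplitudeIntegral s x 1 := by
  rw [amplitudeIntegral, amplitudeIntegral, ← MeasureTheory.integral_const_mul]
  refine MeasureTheory.integral_mono_of_nonneg (Filter.Eventually.of_forall fun γ => ?_)
    ((integrable_amplitude_integrand s x).const_mul _) (Filter.Eventually.of_forall fun γ => ?_)
  · simp only [Pi.zero_apply]
    positivity
  · have h1 : (1 : ℝ) ≤ 1 / σ ^ 2 := by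
      rw [le_div_iff₀ (by positivity), one_mul]
      exact pow_le_one₀ hσ.le hσ1
    have h2 : Real.exp (-(1 / σ ^ 2) * misfit s x γ)
        ≤ Real.exp (-(δ * (1 / σ ^ 2 - 1))) * Real.exp (-(1 / 1 ^ 2) * misfit s x γ) := by
      rw [← Real.exp_add, Real.exp_le_exp]
      have := mul_le_mul_of_nonneg_right (hδ γ) (sub_nonneg.2 h1)
      norm_num at *
      linarith
    calc _ ≤ ‖vand x‖ ^ 8 * (∏ h, ‖γ h‖ ^ 2) * _ := mul_le_mul_of_nonneg_left h2 (by positivity)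
      _ = _ := by ring

lemma continuous_nodes {p : ℕ} (j : Fin p) (z : ℂ) : Continuous fun ζ => nodes j ζ z :=
  (contDiff_nodes (m := 0) j).continuous.comp (Continuous.prodMk continuous_id continuous_const)

lemma stronglyMeasurable_amplitudeIntegral {p : ℕ} (s : Fin (2 * p) → ℂ) (j : Fin p) (z : ℂ)
    (σ : ℝ) : MeasureTheory.StronglyMeasurable fun ζ => amplitudeIntegral s (nodes j ζ z) σ := by
  unfold amplitudeIntegral
  refine MeasureTheory.StronglyMeasurable.integral_prod_right (f := fun ζ γ =>
    ‖vand (nodes j ζ z)‖ ^ 8 * (∏ h, ‖γ h‖ ^ 2) *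
      Real.exp (-(1 / σ ^ 2) * misfit s (nodes j ζ z) γ)) ?_
  exact ((continuous_amplitude_integrand s σ).comp
    (((continuous_nodes j z).comp continuous_fst).prodMk continuous_snd)).stronglyMeasurable

lemma integrable_amplitudeIntegral_one {p : ℕ} (s : Fin (2 * p) → ℂ) (j : Fin p) (z : ℂ) :
    MeasureTheory.Integrable fun ζ : {h : Fin p // h ≠ j} → ℂ =>
      amplitudeIntegral s (nodes j ζ z) 1 := by
  obtain ⟨C, hC, hle⟩ := amplitudeIntegral_one_le s
  have h1 : MeasureTheory.Integrable fun w : ℂ => ((1 + ‖w‖) ^ 4)⁻¹ := by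
    have := integrable_one_add_norm (E := ℂ) (μ := MeasureTheory.volume) (r := 4)
      (by rw [Complex.finrank_real_complex]; norm_num)
    refine this.congr (Filter.Eventually.of_forall fun w => ?_)
    simp only
    rw [Real.rpow_neg (by positivity)]
    norm_cast
  have h2 : MeasureTheory.Integrable fun ζ : {h : Fin p // h ≠ j} → ℂ =>
      ∏ h, ((1 + ‖ζ h‖) ^ 4)⁻¹ :=
    MeasureTheory.Integrable.fintype_prod (f := fun _ (w : ℂ) => ((1 + ‖w‖) ^ 4)⁻¹) fun _ => h1
  refine (h2.const_mul C).mono'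
    (stronglyMeasurable_amplitudeIntegral s j z 1).aestronglyMeasurable
    (Filter.Eventually.of_forall fun ζ => ?_)
  rw [Real.norm_of_nonneg (amplitudeIntegral_nonneg _ _ _)]
  refine (hle _).trans (mul_le_mul_of_nonneg_left ?_ hC)
  have h3 : ∏ h : {h : Fin p // h ≠ j}, ((1 + ‖ζ h‖) ^ 4)⁻¹
      = ∏ h ∈ Finset.univ.erase j, ((1 + ‖nodes j ζ z h‖) ^ 4)⁻¹ := by
    rw [Finset.prod_subtype (p := fun h => h ≠ j) (Finset.univ.erase j) (by simp)]
    refine Finset.prod_congr rfl fun h _ => ?_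
    rw [nodes, dif_neg h.2]
  rw [h3, ← Finset.prod_erase_mul _ _ (Finset.mem_univ j)]
  -- The factor of the fixed node `z` is at most `1` and is dropped.
  refine mul_le_of_le_one_right (Finset.prod_nonneg fun _ _ => by positivity) ?_
  exact inv_le_one_of_one_le₀ (one_le_pow₀ (by linarith [norm_nonneg (nodes j ζ z j)]))

lemma integrable_amplitudeIntegral {p : ℕ} (s : Fin (2 * p) → ℂ) (j : Fin p) (z : ℂ) {σ : ℝ}
    (hσ : 0 < σ) (hσ1 : σ ≤ 1) :
    MeasureTheory.Integrable fun ζ : {h : Fin p // h ≠ j} → ℂ =>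
      amplitudeIntegral s (nodes j ζ z) σ := by
  refine (integrable_amplitudeIntegral_one s j z).mono'
    (stronglyMeasurable_amplitudeIntegral s j z σ).aestronglyMeasurable
    (Filter.Eventually.of_forall fun ζ => ?_)
  rw [Real.norm_of_nonneg (amplitudeIntegral_nonneg _ _ _)]
  simpa using amplitudeIntegral_le s (fun γ => misfit_nonneg s (nodes j ζ z) γ) hσ hσ1

/-! ### Symmetry -/

lemma norm_vand_comp_perm {p : ℕ} (x : Fin p → ℂ) (π : Equiv.Perm (Fin p)) :
    ‖vand (x ∘ π)‖ = ‖vand x‖ := by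
  rw [← sq_eq_sq₀ (norm_nonneg _) (norm_nonneg _), norm_vand_sq, norm_vand_sq,
    ← Equiv.prod_comp π (fun h => ∏ k ∈ Finset.univ.erase h, ‖x h - x k‖)]
  refine Finset.prod_congr rfl fun h _ => ?_
  refine Finset.prod_equiv π (fun k => by simp) fun k _ => rfl

lemma misfit_comp_perm {p : ℕ} (s : Fin (2 * p) → ℂ) (x γ : Fin p → ℂ)
    (π : Equiv.Perm (Fin p)) : misfit s (x ∘ π) (γ ∘ π) = misfit s x γ := by
  unfold misfit
  refine Finset.sum_congr rfl fun k _ => ?_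
  rw [← Equiv.sum_comp π (fun h => γ h * x h ^ (k : ℕ))]
  rfl

lemma integral_comp_perm {ι : Type*} [Fintype ι] (π : Equiv.Perm ι) (S : Set (ι → ℂ))
    (f : (ι → ℂ) → ℝ) :
    ∫ w in (fun w : ι → ℂ => w ∘ π) ⁻¹' S, f (w ∘ π) = ∫ w in S, f w := by
  have h1 := MeasureTheory.volume_measurePreserving_piCongrLeft (fun _ : ι => ℂ) π.symm
  have h2 : ⇑(MeasurableEquiv.piCongrLeft (fun _ : ι => ℂ) π.symm) = fun w : ι → ℂ => w ∘ π := by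
    ext w i
    rw [MeasurableEquiv.coe_piCongrLeft]
    have := Equiv.piCongrLeft_apply_apply (fun _ : ι => ℂ) π.symm w (π i)
    simpa using this
  have h3 := h1.setIntegral_preimage_emb (MeasurableEquiv.measurableEmbedding _) f S
  rwa [h2] at h3

lemma amplitudeIntegral_comp_perm {p : ℕ} (s : Fin (2 * p) → ℂ) (x : Fin p → ℂ) (σ : ℝ)
    (π : Equiv.Perm (Fin p)) : amplitudeIntegral s (x ∘ π) σ = amplitudeIntegral s x σ := by
  have h1 := integral_comp_perm π Set.univ (fun γ =>
    ‖vand (x ∘ π)‖ ^ 8 * (∏ h, ‖γ h‖ ^ 2) * Real.exp (-(1 / σ ^ 2) * misfit s (x ∘ π) γ))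
  simp only [Set.preimage_univ, MeasureTheory.setIntegral_univ] at h1
  rw [amplitudeIntegral, ← h1, amplitudeIntegral]
  congr 1
  ext γ
  rw [norm_vand_comp_perm, misfit_comp_perm]
  congr 2
  exact Equiv.prod_comp π (fun h => ‖γ h‖ ^ 2)


/-! ### The Hessian in real coordinates -/

lemma sum_realVec_smul_realDir {ι : Type} [Fintype ι] [DecidableEq ι] (w : ι → ℂ) :
    ∑ a, realVec w a • realDir a = w := by
  ext h
  rw [Fintype.sum_sum_type, Pi.add_apply, Finset.sum_apply, Finset.sum_apply]
  simp [realVec, realDir, Pi.single_apply]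

lemma realHessian_apply {ι : Type} [Fintype ι] [DecidableEq ι] {F : (ι → ℂ) → ℝ} {x : ι → ℂ}
    (hF : ContDiffAt ℝ 2 F x) (a b : ι ⊕ ι) :
    realHessian F x a b = fderiv ℝ (fderiv ℝ F) x (realDir a) (realDir b) := by
  have h1 : ContDiffAt ℝ 1 (fderiv ℝ F) x := hF.fderiv_right (by norm_num)
  have h2 := (h1.differentiableAt (by norm_num)).hasFDerivAt.clm_apply
    (hasFDerivAt_const (realDir b) x)
  rw [realHessian, Matrix.of_apply, h2.fderiv]
  simp

lemma realVec_dotProduct_realHessian {ι : Type} [Fintype ι] [DecidableEq ι] {F : (ι → ℂ) → ℝ}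
    {x : ι → ℂ} (hF : ContDiffAt ℝ 2 F x) (w : ι → ℂ) :
    realVec w ⬝ᵥ (realHessian F x *ᵥ realVec w) = fderiv ℝ (fderiv ℝ F) x w w := by
  conv_rhs => rw [← sum_realVec_smul_realDir w]
  simp only [map_sum, map_smul, sum_apply, smul_apply,
    smul_eq_mul, dotProduct, Matrix.mulVec, realHessian_apply hF, Finset.mul_sum]
  rw [Finset.sum_comm]
  exact Finset.sum_congr rfl fun _ _ => Finset.sum_congr rfl fun _ _ => by ring

lemma realHessian_posDef {ι : Type} [Fintype ι] [DecidableEq ι] {F : (ι → ℂ) → ℝ}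
    {x : ι → ℂ} (hF : ContDiffAt ℝ 2 F x) {c : ℝ} (hc : 0 < c)
    (h : ∀ v, c * ‖v‖ ^ 2 ≤ fderiv ℝ (fderiv ℝ F) x v v) : (realHessian F x).PosDef := by
  refine Matrix.PosDef.of_dotProduct_mulVec_pos ?_ ?_
  · ext a b
    rw [Matrix.conjTranspose_apply, star_trivial, realHessian_apply hF, realHessian_apply hF]
    exact (hF.isSymmSndFDerivAt (by simp)).eq _ _
  · intro y hy
    obtain ⟨v, rfl⟩ := realVec_surjective y
    rw [star_trivial, realVec_dotProduct_realHessian hF]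
    have hv : 0 < ‖v‖ := norm_pos_iff.2 fun h => hy (realVec_eq_zero.2 h)
    exact lt_of_lt_of_le (by positivity) (h v)

/-- The half in front of a form in `2m` real variables contributes `2^m` and turns `π^m` into
`(2π)^m`. -/
lemma integral_exp_neg_half_hessian {ι : Type} [Fintype ι] [DecidableEq ι] {F : (ι → ℂ) → ℝ}
    {x : ι → ℂ} (hF : ContDiffAt ℝ 2 F x) (hH : (realHessian F x).PosDef) :
    ∫ w : ι → ℂ, Real.exp (-(fderiv ℝ (fderiv ℝ F) x w w / 2))
      = (2 * Real.pi) ^ Fintype.card ι / √(realHessian F x).det := by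
  have h1 := integral_exp_neg_quadratic (hH.smul (half_pos (one_pos (α := ℝ))))
  simp only [Matrix.smul_mulVec, dotProduct_smul, realVec_dotProduct_realHessian hF,
    smul_eq_mul, Matrix.det_smul, Fintype.card_sum] at h1
  have h2 : √((1 / 2 : ℝ) ^ (Fintype.card ι + Fintype.card ι) * (realHessian F x).det)
      = (1 / 2) ^ Fintype.card ι * √(realHessian F x).det := by
    rw [← two_mul, mul_comm 2, pow_mul, Real.sqrt_mul (by positivity), Real.sqrt_sq (by positivity)]
  rw [h2] at h1
  simp_rw [div_eq_inv_mul (fderiv ℝ (fderiv ℝ F) x _ _) (2 : ℝ), ← one_div]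
  rw [h1, mul_pow, one_div_pow]
  have := Real.sqrt_pos.2 hH.det_pos
  field_simp

/-! ### The leading coefficient -/

lemma funG_pos {p : ℕ} {s : Fin (2 * p) → ℂ} {j : Fin p} {ζ : {h : Fin p // h ≠ j} → ℂ} {z : ℂ}
    (hx : Function.Injective (nodes j ζ z)) (hampl : ∀ h, ampl s (nodes j ζ z) h ≠ 0)
    (hH : (hessNu s j ζ z).PosDef) : 0 < funG s j ζ z := by
  have h1 : 0 < ∏ i, ‖ampl s (nodes j ζ z) i‖ ^ 2 :=
    Finset.prod_pos fun i _ => pow_pos (norm_pos_iff.2 (hampl i)) 2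
  have h2 : 0 < ‖vander j ζ z‖ := norm_vand_pos hx
  have h3 := detD_pos j ζ z hx
  have h4 := Real.rpow_pos_of_pos hH.det_pos (-(1 / 2))
  rw [funG, funK_eq s j ζ z hx]
  positivity

lemma card_ne {p : ℕ} (j : Fin p) : Fintype.card {h : Fin p // h ≠ j} = p - 1 := by
  rw [Fintype.card_subtype_compl, Fintype.card_fin, Fintype.card_subtype_eq]

/-- This exhibits `G_j` as the normalization `π^(-2p)` times the inner Gaussian integral over
amplitudes times the outer one over nodes. -/
lemma funG_eq {p : ℕ} {s : Fin (2 * p) → ℂ} {j : Fin p} {ζ : {h : Fin p // h ≠ j} → ℂ} {z : ℂ}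
    (hx : Function.Injective (nodes j ζ z)) (hH : (hessNu s j ζ z).PosDef) :
    funG s j ζ z = (Real.pi ^ (2 * p))⁻¹ * (reducedIntegral s 0 (nodes j ζ z) *
      ((2 * Real.pi) ^ (p - 1) / √(hessNu s j ζ z).det)) := by
  have hp : 1 ≤ p := j.pos
  have h1 : (2 * Real.pi) ^ ((p : ℝ) - 1) = (2 * Real.pi) ^ (p - 1) := by
    rw [← Real.rpow_natCast, Nat.cast_sub hp, Nat.cast_one]
  have h2 : (hessNu s j ζ z).det ^ (-(1 / 2) : ℝ) = (√(hessNu s j ζ z).det)⁻¹ := by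
    rw [Real.rpow_neg hH.det_pos.le, Real.sqrt_eq_rpow]
  have h3 : ‖vander j ζ z‖ = ‖vand (nodes j ζ z)‖ := rfl
  rw [funG, funK_eq s j ζ z hx, reducedIntegral_zero s hx, h1, h2, h3, detD, realQ_eq, two_mul p,
    pow_add]
  field_simp

/-! ### The local asymptotics -/

open MeasureTheory Filter in
lemma densityIntegral_isEquivalent {p : ℕ} {s : Fin (2 * p) → ℂ} {j : Fin p}
    {D : Set ({h : Fin p // h ≠ j} → ℂ)} (hD : IsOpen D) (hDc : Convex ℝ D) {z : ℂ}
    (hinj : ∀ ζ ∈ D, Function.Injective (nodes j ζ z))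
    {ζ₁ : {h : Fin p // h ≠ j} → ℂ} (hζ₁ : ζ₁ ∈ D)
    (hsmooth : ContDiffOn ℝ 2 (fun ζ => nu s j ζ z) D)
    (hcrit : fderiv ℝ (fun ζ => nu s j ζ z) ζ₁ = 0) {c : ℝ} (hc : 0 < c)
    (hquad : ∀ ζ ∈ D, c / 2 * ‖ζ - ζ₁‖ ^ 2 ≤ nu s j ζ z - nu s j ζ₁ z)
    (hH : (hessNu s j ζ₁ z).PosDef) (hG : 0 < funG s j ζ₁ z) {C : ℝ}
    (hbound : ∀ᶠ σ in 𝓝[>] (0 : ℝ), ∀ ζ ∈ D, |reducedIntegral s σ (nodes j ζ z)| ≤ C) :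
    (fun σ : ℝ => densityIntegral s j D z σ) ~[𝓝[>] 0]
      fun σ : ℝ => laplaceApprox s j ζ₁ z σ := by
  set f : ({h : Fin p // h ≠ j} → ℂ) → ℝ := fun ζ => nu s j ζ z
  have hp : 1 ≤ p := j.pos
  have hamp : ∀ σ : ℝ, 0 < σ → ∀ ζ ∈ D, amplitudeIntegral s (nodes j ζ z) σ =
      σ ^ (2 * p) * Real.exp (-f ζ₁ / σ ^ 2) *
        (reducedIntegral s σ (nodes j ζ z) * Real.exp (-(f ζ - f ζ₁) / σ ^ 2)) := by
    intro σ hσ ζ hζ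
    have h1 : Real.exp (-f ζ / σ ^ 2)
        = Real.exp (-f ζ₁ / σ ^ 2) * Real.exp (-(f ζ - f ζ₁) / σ ^ 2) := by
      rw [← Real.exp_add]
      congr 1
      ring
    rw [amplitudeIntegral_eq s (hinj ζ hζ) hσ, ← nu_eq_misfit s j ζ z (hinj ζ hζ), h1]
    ring
  have hC2 : ContDiffAt ℝ 2 f ζ₁ := hsmooth.contDiffAt (hD.mem_nhds hζ₁)
  have hlap := tendsto_laplace (volume : Measure ({h : Fin p // h ≠ j} → ℂ))
    hD.measurableSet (hD.mem_nhds hζ₁) (half_pos hc) hquad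
    (tendsto_taylor_two hD hDc hsmooth hζ₁ hcrit)
    (g := fun σ ζ => reducedIntegral s σ (nodes j ζ z)) (L := reducedIntegral s 0 (nodes j ζ₁ z))
    hbound ?_ ?_
  · rw [integral_exp_neg_half_hessian hC2 hH, card_ne, finrank_pi_complex, card_ne] at hlap
    have hlim : Tendsto (fun σ : ℝ => (Real.pi ^ (2 * p))⁻¹ * ((σ ^ (2 * (p - 1)))⁻¹ *
        ∫ ζ in D, reducedIntegral s σ (nodes j ζ z) * Real.exp (-(f ζ - f ζ₁) / σ ^ 2)))
        (𝓝[>] 0) (𝓝 (funG s j ζ₁ z)) := by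
      rw [funG_eq (hinj ζ₁ hζ₁) hH]
      exact hlap.const_mul _
    have hone := hlim.div_const (funG s j ζ₁ z)
    rw [div_self hG.ne'] at hone
    have hne : ∀ᶠ σ in 𝓝[>] (0 : ℝ), laplaceApprox s j ζ₁ z σ ≠ 0 := by
      filter_upwards [self_mem_nhdsWithin] with σ hσ
      have hσ0 : (0 : ℝ) < σ := hσ
      rw [laplaceApprox]
      positivity
    rw [Asymptotics.isEquivalent_iff_tendsto_one hne]
    refine hone.congr' ?_
    filter_upwards [self_mem_nhdsWithin] with σ hσ
    have hσ0 : (0 : ℝ) < σ := hσ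
    rw [Pi.div_apply, densityIntegral_eq, setIntegral_congr_fun hD.measurableSet (hamp σ hσ0),
      integral_const_mul, laplaceApprox]
    have h3 : σ ^ (2 * p) = σ ^ (2 * (p - 1)) * σ ^ 2 := by
      rw [← pow_add]
      congr 1
      omega
    rw [mul_pow, ← pow_mul, show 2 * (2 * p) = 2 * p + 2 * p by ring, pow_add, h3]
    have h4 := Real.exp_pos (-f ζ₁ / σ ^ 2)
    simp only [f] at h4 ⊢
    field_simp
  · have h1 : ContinuousAt (fun a : ℝ × ({h : Fin p // h ≠ j} → ℂ) =>
        reducedIntegral s a.1 (nodes j a.2 z)) (0, ζ₁) :=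
      ContinuousAt.comp (g := fun a : ℝ × (Fin p → ℂ) => reducedIntegral s a.1 a.2)
        (f := fun a : ℝ × ({h : Fin p // h ≠ j} → ℂ) => (a.1, nodes j a.2 z)) (x := (0, ζ₁))
        (continuousAt_reducedIntegral s (hinj ζ₁ hζ₁) 0)
        (continuous_fst.prodMk ((continuous_nodes j z).comp continuous_snd)).continuousAt
    refine h1.tendsto.mono_left ?_
    rw [nhds_prod_eq]
    exact Filter.prod_mono nhdsWithin_le_nhds le_rfl
  · filter_upwards [self_mem_nhdsWithin] with σ hσ
    have hσ0 : (0 : ℝ) < σ := hσ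
    -- On `D` the integrand is a constant multiple of the amplitude integral, whose measurability in
    -- the nodes is known on the whole space.
    have h1 : D.indicator (fun ζ => reducedIntegral s σ (nodes j ζ z) *
          Real.exp (-(f ζ - f ζ₁) / σ ^ 2))
        = D.indicator fun ζ => (σ ^ (2 * p) * Real.exp (-f ζ₁ / σ ^ 2))⁻¹ *
          amplitudeIntegral s (nodes j ζ z) σ := by
      refine Set.indicator_congr fun ζ hζ => ?_
      rw [hamp σ hσ0 ζ hζ, inv_mul_cancel_left₀ (by positivity)]
    rw [h1]
    exact ((stronglyMeasurable_amplitudeIntegral s j z σ).measurable.const_mul _).indicator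
      hD.measurableSet

/-! ### All configurations -/

lemma nodes_comp_perm {p : ℕ} (j : Fin p) (ζ : {h : Fin p // h ≠ j} → ℂ) (z : ℂ)
    (τ : Equiv.Perm {h : Fin p // h ≠ j}) :
    nodes j (ζ ∘ τ) z = nodes j ζ z ∘ Equiv.Perm.ofSubtype τ := by
  ext h
  by_cases hj : h = j
  · have : Equiv.Perm.ofSubtype τ h = h :=
      Equiv.Perm.ofSubtype_apply_of_not_mem τ (not_not.2 hj)
    rw [Function.comp_apply, this, nodes, nodes, dif_pos hj, dif_pos hj]
  · rw [Function.comp_apply, Equiv.Perm.ofSubtype_apply_of_mem τ hj, nodes, nodes, dif_neg hj,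
      dif_neg (τ ⟨h, hj⟩).2]
    rfl

lemma exists_perm_comp_mem_ball {p : ℕ} {ξ : Fin p → ℂ} {ε : ℝ} (hε : 0 < ε)
    (hsep : ∀ h k, h ≠ k → 2 * ε ≤ ‖ξ h - ξ k‖) {j : Fin p} {ζ : {h : Fin p // h ≠ j} → ℂ}
    {z : ℂ} (hz : ‖z - ξ j‖ < ε) {π : Equiv.Perm (Fin p)}
    (hπ : ∀ i, ‖nodes j ζ z (π i) - ξ i‖ < ε) :
    ∃ τ : Equiv.Perm {h : Fin p // h ≠ j}, ζ ∘ τ ∈ Metric.ball (fun h => ξ h.1) ε := by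
  -- The node `z` lies within `ε` of `ξ j`, and by separation of no other true node; so `π` fixes
  -- `j` and restricts to the other indices.
  have hj : π j = j := by
    have h1 := hπ (π.symm j)
    rw [Equiv.apply_symm_apply, nodes, dif_pos rfl] at h1
    by_contra hne
    have h2 := hsep j (π.symm j) fun h => hne (by
      conv_lhs => rw [h]
      simp)
    have h3 : ‖ξ j - ξ (π.symm j)‖ ≤ ‖z - ξ j‖ + ‖z - ξ (π.symm j)‖ := by
      rw [norm_sub_rev z]
      simpa using norm_add_le (ξ j - z) (z - ξ (π.symm j))
    linarith
  have hne : ∀ h, π h ≠ j ↔ h ≠ j := fun h => by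
    rw [not_iff_not]
    exact ⟨fun h1 => π.injective (h1.trans hj.symm), fun h1 => by rw [h1, hj]⟩
  refine ⟨π.subtypePerm hne, ?_⟩
  rw [Metric.mem_ball, dist_pi_lt_iff hε]
  intro h
  have h1 := hπ h.1
  rw [nodes, dif_neg ((hne h.1).2 h.2)] at h1
  rw [dist_eq_norm]
  exact h1

lemma perm_eq_of_comp_mem_ball {ι : Type*} [Fintype ι] {ξ ζ : ι → ℂ} {ε : ℝ} (hε : 0 < ε)
    (hsep : ∀ h k, h ≠ k → 2 * ε ≤ ‖ξ h - ξ k‖) {τ τ' : Equiv.Perm ι}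
    (hτ : ζ ∘ τ ∈ Metric.ball ξ ε) (hτ' : ζ ∘ τ' ∈ Metric.ball ξ ε) : τ = τ' := by
  rw [Metric.mem_ball, dist_pi_lt_iff hε] at hτ hτ'
  ext h
  by_contra hne
  have h1 := hτ h
  have h2 := hτ' (τ'.symm (τ h))
  simp only [Function.comp_apply, Equiv.apply_symm_apply, dist_eq_norm] at h1 h2
  have h3 := hsep h (τ'.symm (τ h)) fun heq => hne (by
    conv_rhs => rw [heq]
    simp)
  have h4 : ‖ξ h - ξ (τ'.symm (τ h))‖ ≤ ‖ζ (τ h) - ξ h‖ + ‖ζ (τ h) - ξ (τ'.symm (τ h))‖ := by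
    rw [norm_sub_rev (ζ (τ h)) (ξ h)]
    simpa using norm_add_le (ξ h - ζ (τ h)) (ζ (τ h) - ξ (τ'.symm (τ h)))
  linarith

/-- The full integral splits into the permuted copies of a small ball and a remainder. -/
lemma integral_amplitudeIntegral_split {p : ℕ} (s : Fin (2 * p) → ℂ) {ξ : Fin p → ℂ} {ε : ℝ}
    (hε : 0 < ε) (hsep : ∀ h k, h ≠ k → 2 * ε ≤ ‖ξ h - ξ k‖) (j : Fin p) (z : ℂ) {σ : ℝ}
    (hσ : 0 < σ) (hσ1 : σ ≤ 1) :
    ∫ ζ : {h : Fin p // h ≠ j} → ℂ, amplitudeIntegral s (nodes j ζ z) σ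
      = ((p - 1).factorial : ℝ) * (∫ ζ in Metric.ball (fun h : {h : Fin p // h ≠ j} => ξ h.1) ε,
          amplitudeIntegral s (nodes j ζ z) σ) +
        ∫ ζ in {ζ | ∀ τ : Equiv.Perm {h : Fin p // h ≠ j},
          ζ ∘ τ ∉ Metric.ball (fun h => ξ h.1) ε}, amplitudeIntegral s (nodes j ζ z) σ := by
  have hint := integrable_amplitudeIntegral s j z hσ hσ1
  set D := Metric.ball (fun h : {h : Fin p // h ≠ j} => ξ h.1) ε
  have hcont : ∀ τ : Equiv.Perm {h : Fin p // h ≠ j},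
      Continuous fun ζ : {h : Fin p // h ≠ j} → ℂ => ζ ∘ τ := fun τ => by fun_prop
  have hopen : ∀ τ : Equiv.Perm {h : Fin p // h ≠ j},
      IsOpen ((fun ζ : {h : Fin p // h ≠ j} → ℂ => ζ ∘ τ) ⁻¹' D) := fun τ =>
    Metric.isOpen_ball.preimage (hcont τ)
  set U := ⋃ τ : Equiv.Perm {h : Fin p // h ≠ j},
    (fun ζ : {h : Fin p // h ≠ j} → ℂ => ζ ∘ τ) ⁻¹' D
  have hU : MeasurableSet U := (isOpen_iUnion hopen).measurableSet
  have hUc : Uᶜ = {ζ | ∀ τ : Equiv.Perm {h : Fin p // h ≠ j}, ζ ∘ τ ∉ D} := by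
    ext ζ
    simp [U]
  rw [← MeasureTheory.integral_add_compl hU hint, hUc]
  congr 1
  rw [MeasureTheory.integral_iUnion_fintype (fun τ => (hopen τ).measurableSet)]
  · have h1 : ∀ τ : Equiv.Perm {h : Fin p // h ≠ j},
        ∫ ζ in (fun ζ : {h : Fin p // h ≠ j} → ℂ => ζ ∘ τ) ⁻¹' D,
          amplitudeIntegral s (nodes j ζ z) σ
        = ∫ ζ in D, amplitudeIntegral s (nodes j ζ z) σ := fun τ => by
      rw [← integral_comp_perm τ D]
      simp only [nodes_comp_perm, amplitudeIntegral_comp_perm]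
    simp only [h1]
    rw [Finset.sum_const, Finset.card_univ, Fintype.card_perm, card_ne, nsmul_eq_mul]
  · intro τ τ' hne
    refine Set.disjoint_left.2 fun ζ hζ hζ' => hne ?_
    exact perm_eq_of_comp_mem_ball hε
      (fun h k hhk => hsep h.1 k.1 fun heq => hhk (Subtype.ext heq)) hζ hζ'
  · exact fun τ => hint.integrableOn

lemma tendsto_inv_sq_pow_mul_exp (n : ℕ) {κ : ℝ} (hκ : 0 < κ) :
    Filter.Tendsto (fun σ : ℝ => (1 / σ ^ 2) ^ n * Real.exp (-(κ * (1 / σ ^ 2)))) (𝓝[>] 0)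
      (𝓝 0) := by
  have h1 : Filter.Tendsto (fun σ : ℝ => κ * (1 / σ ^ 2)) (𝓝[>] 0) Filter.atTop := by
    refine Filter.Tendsto.const_mul_atTop hκ ?_
    have h2 : Filter.Tendsto (fun σ : ℝ => σ⁻¹ ^ 2) (𝓝[>] 0) Filter.atTop :=
      (Filter.tendsto_pow_atTop two_ne_zero).comp tendsto_inv_nhdsGT_zero
    simpa using h2
  have h2 := ((Real.tendsto_pow_mul_exp_neg_atTop_nhds_zero n).comp h1).const_mul (κ ^ n)⁻¹
  rw [mul_zero] at h2
  refine h2.congr fun σ => ?_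
  simp only [Function.comp_apply]
  rw [mul_pow, ← mul_assoc, ← mul_assoc, inv_mul_cancel₀ (by positivity), one_mul]

open MeasureTheory Filter in
-- The ratio is at most a constant times `(1/σ²)^(2p-1) exp(-(δ - ν)/σ²)`: the exponential gap beats
-- the power, which is the prefactor `σ^(-4p)` divided by `σ^(-2)`.
lemma remainder_isLittleO {p : ℕ} (s : Fin (2 * p) → ℂ) {j : Fin p}
    {S : Set ({h : Fin p // h ≠ j} → ℂ)} (hS : MeasurableSet S) {ζ₁ : {h : Fin p // h ≠ j} → ℂ}
    {z : ℂ} {δ : ℝ} (hδ : ∀ ζ ∈ S, ∀ γ, δ ≤ misfit s (nodes j ζ z) γ) (hν : nu s j ζ₁ z < δ)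
    (hG : 0 < funG s j ζ₁ z) :
    (fun σ : ℝ => 1 / (Real.pi * σ ^ 2) ^ (2 * p) *
        ∫ ζ in S, amplitudeIntegral s (nodes j ζ z) σ) =o[𝓝[>] 0]
      fun σ : ℝ => laplaceApprox s j ζ₁ z σ := by
  set K := ∫ ζ in S, amplitudeIntegral s (nodes j ζ z) 1
  have hp : 1 ≤ p := j.pos
  have hne : ∀ᶠ σ in 𝓝[>] (0 : ℝ), laplaceApprox s j ζ₁ z σ = 0 →
      1 / (Real.pi * σ ^ 2) ^ (2 * p) *
        ∫ ζ in S, amplitudeIntegral s (nodes j ζ z) σ = 0 := by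
    filter_upwards [self_mem_nhdsWithin] with σ hσ h0
    have hσ0 : (0 : ℝ) < σ := hσ
    have : 0 < laplaceApprox s j ζ₁ z σ := by rw [laplaceApprox]; positivity
    exact absurd h0 this.ne'
  rw [Asymptotics.isLittleO_iff_tendsto' hne]
  have hmaj := (tendsto_inv_sq_pow_mul_exp (2 * p - 1) (sub_pos.2 hν)).const_mul
    ((Real.pi ^ (2 * p))⁻¹ * (funG s j ζ₁ z)⁻¹ * Real.exp δ * K)
  rw [mul_zero] at hmaj
  refine squeeze_zero' ?_ ?_ hmaj
  · filter_upwards [self_mem_nhdsWithin] with σ hσ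
    have hσ0 : (0 : ℝ) < σ := hσ
    have h1 : 0 ≤ ∫ ζ in S, amplitudeIntegral s (nodes j ζ z) σ :=
      integral_nonneg fun ζ => amplitudeIntegral_nonneg _ _ _
    rw [laplaceApprox]
    positivity
  · filter_upwards [self_mem_nhdsWithin, nhdsWithin_le_nhds (Iio_mem_nhds one_pos)] with σ hσ hσ1
    have hσ0 : (0 : ℝ) < σ := hσ
    have hσ1' : σ ≤ 1 := le_of_lt hσ1
    have h1 : ∫ ζ in S, amplitudeIntegral s (nodes j ζ z) σ
        ≤ Real.exp (-(δ * (1 / σ ^ 2 - 1))) * K := by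
      rw [← integral_const_mul]
      refine setIntegral_mono_on (integrable_amplitudeIntegral s j z hσ0 hσ1').integrableOn
        ((integrable_amplitudeIntegral_one s j z).integrableOn.const_mul _) hS fun ζ hζ => ?_
      exact amplitudeIntegral_le s (hδ ζ hζ) hσ0 hσ1'
    have hpos : 0 < laplaceApprox s j ζ₁ z σ := by rw [laplaceApprox]; positivity
    rw [div_le_iff₀ hpos, laplaceApprox]
    refine (mul_le_mul_of_nonneg_left h1 (by positivity)).trans (le_of_eq ?_)
    have h2 : Real.exp (-(δ * (1 / σ ^ 2 - 1))) = Real.exp δ *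
        Real.exp (-((δ - nu s j ζ₁ z) * (1 / σ ^ 2))) * Real.exp (-(nu s j ζ₁ z) / σ ^ 2) := by
      rw [← Real.exp_add, ← Real.exp_add]
      congr 1
      ring
    have h3 : (1 / (σ ^ 2)) ^ (2 * p) = (1 / σ ^ 2) ^ (2 * p - 1) * (σ ^ 2)⁻¹ := by
      rw [← one_div, ← pow_succ, Nat.sub_add_cancel (by omega)]
    rw [h2, mul_pow, ← one_div_mul_one_div, ← one_div_pow (σ ^ 2), h3, one_div (Real.pi ^ (2 * p))]
    field_simp

open MeasureTheory Filter in
lemma condensedDensity_isEquivalent {p : ℕ} {ξ : Fin p → ℂ} {s : Fin (2 * p) → ℂ} {ε δ : ℝ}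
    (hε : 0 < ε) (hsep : ∀ h k, h ≠ k → 2 * ε ≤ ‖ξ h - ξ k‖)
    (hδ : ∀ x γ, misfit s x γ < δ → ∃ π : Equiv.Perm (Fin p), ∀ i, ‖x (π i) - ξ i‖ < ε)
    {j : Fin p} {z : ℂ} (hz : ‖z - ξ j‖ < ε) {ζ₁ : {h : Fin p // h ≠ j} → ℂ}
    (hν : nu s j ζ₁ z < δ) (hG : 0 < funG s j ζ₁ z)
    (hloc : (fun σ : ℝ => densityIntegral s j (Metric.ball (fun h => ξ h.1) ε) z σ) ~[𝓝[>] 0]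
      fun σ : ℝ => laplaceApprox s j ζ₁ z σ) :
    (fun σ : ℝ => condensedDensity s j z σ) ~[𝓝[>] 0]
      fun σ : ℝ => laplaceApprox s j ζ₁ z σ := by
  set S := {ζ : {h : Fin p // h ≠ j} → ℂ | ∀ τ : Equiv.Perm {h : Fin p // h ≠ j},
          ζ ∘ τ ∉ Metric.ball (fun h => ξ h.1) ε}
  have hS : MeasurableSet S := by
    have : S = ⋂ τ : Equiv.Perm {h : Fin p // h ≠ j},
        ((fun ζ : {h : Fin p // h ≠ j} → ℂ => ζ ∘ τ) ⁻¹' Metric.ball (fun h => ξ h.1) ε)ᶜ := by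
      ext ζ
      simp [S]
    rw [this]
    exact MeasurableSet.iInter fun τ =>
      (Metric.isOpen_ball.preimage (by fun_prop)).measurableSet.compl
  have hfar : ∀ ζ ∈ S, ∀ γ, δ ≤ misfit s (nodes j ζ z) γ := by
    intro ζ hζ γ
    by_contra! hlt
    obtain ⟨π, hπ⟩ := hδ _ _ hlt
    obtain ⟨τ, hτ⟩ := exists_perm_comp_mem_ball hε hsep hz hπ
    exact hζ τ hτ
  have hrem := (remainder_isLittleO s hS hfar hν hG).const_mul_left
    (1 / ((p - 1).factorial : ℝ))
  refine (hloc.add_isLittleO hrem).congr_left ?_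
  filter_upwards [self_mem_nhdsWithin, nhdsWithin_le_nhds (Iio_mem_nhds one_pos)] with σ hσ hσ1
  have hσ0 : (0 : ℝ) < σ := hσ
  have hfac : ((p - 1).factorial : ℝ) ≠ 0 := by exact_mod_cast Nat.factorial_ne_zero _
  rw [Pi.add_apply, condensedDensity, densityIntegral_eq, densityIntegral_eq, setIntegral_univ,
    integral_amplitudeIntegral_split s hε hsep j z hσ0 (le_of_lt hσ1)]
  field_simp
  rfl


/-! ### Choice of the neighbourhoods and conclusion -/

lemma exists_separation {ι : Type*} [Finite ι] {ξ : ι → ℂ} (hξ : Function.Injective ξ) :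
    ∃ ε : ℝ, 0 < ε ∧ ∀ h k, h ≠ k → 2 * ε ≤ ‖ξ h - ξ k‖ := by
  obtain ⟨τ, hτ, h⟩ := exists_pos_eventually_le (x₀ := ())
    (w := fun (a : {a : ι × ι // a.1 ≠ a.2}) (_ : Unit) => ‖ξ a.1.1 - ξ a.1.2‖)
    (fun _ => continuousAt_const) fun a => norm_pos_iff.2 (sub_ne_zero.2 fun h => a.2 (hξ h))
  refine ⟨τ / 2, half_pos hτ, fun a b hab => ?_⟩
  have := h.self_of_nhds ⟨(a, b), hab⟩
  simpa [mul_div_cancel₀] using this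

end

theorem theorem2p1 (p : ℕ) (hp : 2 ≤ p) (ξ c : Fin p → ℂ) (hξ : Function.Injective ξ)
    (hc : ∀ h, c h ≠ 0) (j : Fin p) :
    ∃ N : Set ℂ, IsOpen N ∧ ξ j ∈ N ∧
    ∃ D : Set ({h : Fin p // h ≠ j} → ℂ), IsOpen D ∧ (fun h => ξ h.1) ∈ D ∧
    ∃ ζhat : ℂ → ({h : Fin p // h ≠ j} → ℂ),
      ContinuousOn ζhat N ∧ ζhat (ξ j) = (fun h => ξ h.1) ∧
      ∀ z ∈ N,
        -- the unique minimum point of `ν_j(·, z)` in `D`, nondegenerate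
        (ζhat z ∈ D ∧
          ∀ w ∈ D, w ≠ ζhat z → nu (signal p ξ c) j (ζhat z) z < nu (signal p ξ c) j w z) ∧
        (hessNu (signal p ξ c) j (ζhat z) z).PosDef ∧
        0 < funG (signal p ξ c) j (ζhat z) z ∧
        -- the asymptotic equivalence, for the condensed density
        ((fun σ : ℝ => condensedDensity (signal p ξ c) j z σ) ~[𝓝[>] 0]
          fun σ : ℝ => laplaceApprox (signal p ξ c) j (ζhat z) z σ) ∧
        -- and for the integral over ordered tuples with each `ζ_h` labelled by `ξ_h`
        ((fun σ : ℝ => densityIntegral (signal p ξ c) j D z σ) ~[𝓝[>] 0]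
          fun σ : ℝ => laplaceApprox (signal p ξ c) j (ζhat z) z σ) := by
  set s := signal p ξ c
  set ξ' : {h : Fin p // h ≠ j} → ℂ := fun h => ξ h.1
  have hnodes : nodes j ξ' (ξ j) = ξ := nodes_self j ξ
  have hinj₀ : Function.Injective (nodes j ξ' (ξ j)) := by rwa [hnodes]
  have htend : Filter.Tendsto (fun a : ({h : Fin p // h ≠ j} → ℂ) × ℂ => nodes j a.1 a.2)
      (𝓝 (ξ', ξ j)) (𝓝 ξ) := by
    have := (contDiff_nodes (m := 0) j).continuous.tendsto (ξ', ξ j)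
    rwa [hnodes] at this
  -- properties near the true nodes
  obtain ⟨κ, hκ, hlow⟩ := exists_eventually_le_misfit hξ hc
  have hlow' : ∀ᶠ a : ({h : Fin p // h ≠ j} → ℂ) × ℂ in 𝓝 (ξ', ξ j),
      κ * ‖a.1 - ξ'‖ ^ 2 ≤ nu s j a.1 a.2 := by
    filter_upwards [htend.eventually hlow, htend.eventually (eventually_injective hξ)]
      with a ha hai
    rw [nu_eq_misfit s j a.1 a.2 hai, ← le_div_iff₀' hκ]
    refine (Real.le_sqrt (norm_nonneg _) (div_nonneg (misfit_nonneg _ _ _) hκ.le)).1 ?_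
    refine (pi_norm_le_iff_of_nonneg (Real.sqrt_nonneg _)).2 fun h => ?_
    refine (Real.le_sqrt (norm_nonneg _) (div_nonneg (misfit_nonneg _ _ _) hκ.le)).2 ?_
    rw [le_div_iff₀' hκ]
    have := ha h.1 (ampl s (nodes j a.1 a.2))
    rwa [nodes, dif_neg h.2] at this
  have hν₀ : nu s j ξ' (ξ j) = 0 := by
    rw [nu_eq_misfit s j ξ' (ξ j) hinj₀, hnodes]
    exact misfit_ampl_signal hξ
  have hampl : ∀ᶠ x in 𝓝 ξ, ∀ h, ampl s x h ≠ 0 := by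
    refine Filter.eventually_all.2 fun h => ?_
    have h1 : ContinuousAt (fun x => ampl s x h) ξ :=
      continuousAt_pi.1 (contDiffAt_ampl (m := 0) s hξ).continuousAt h
    exact h1.eventually_ne (by rw [ampl_signal hξ]; exact hc h)
  -- Continuity at `(0, ξ)` bounds the rescaled integral on a product neighbourhood, so one bound
  -- holds for all small `σ` and all nearby nodes.
  have hred := (continuousAt_reducedIntegral s hξ 0).abs.eventually
    (gt_mem_nhds (lt_add_one _))
  rw [nhds_prod_eq] at hred
  obtain ⟨Pσ, hPσ, Px, hPx, hredP⟩ := Filter.eventually_prod_iff.1 hred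
  obtain ⟨r₁, hr₁, hgood⟩ := Metric.eventually_nhds_iff_ball.1
    (htend.eventually ((eventually_injective hξ).and (hampl.and hPx)))
  obtain ⟨r₂, hr₂, hfam⟩ := exists_minimizer_family (F := fun ζ z => nu s j ζ z)
    (contDiffAt_nu s j hinj₀) hκ hlow' hν₀
  obtain ⟨r₃, hr₃, hsep₃⟩ := exists_separation hξ
  -- the choice of the neighbourhoods
  set ε := min r₁ (min r₂ r₃)
  have hε : 0 < ε := lt_min hr₁ (lt_min hr₂ hr₃)
  have hsep : ∀ h k, h ≠ k → 2 * ε ≤ ‖ξ h - ξ k‖ := fun h k hhk =>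
    le_trans (by gcongr; exact (min_le_right _ _).trans (min_le_right _ _)) (hsep₃ h k hhk)
  -- The order of choices matters: `ε` fixes the ball of nodes, `δ` is the misfit guaranteed away
  -- from its permuted copies, and only then is `ρ` shrunk so that the minimum of `ν` stays below
  -- `δ`.
  obtain ⟨δ, hδ, hperm⟩ := exists_perm_of_misfit_lt hξ hc hε hsep
  obtain ⟨ρ, hρ, hρε, m, hmcont, hm₀, hm⟩ := hfam ε hε
    ((min_le_right _ _).trans (min_le_left _ _)) δ hδ
  refine ⟨Metric.ball (ξ j) ρ, Metric.isOpen_ball, Metric.mem_ball_self hρ,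
    Metric.ball ξ' ε, Metric.isOpen_ball, Metric.mem_ball_self hε, m, hmcont, hm₀,
    fun z hz => ?_⟩
  obtain ⟨hmD, hmδ, hsmooth, hcrit, hquad, hhess⟩ := hm z hz
  have hD : ∀ ζ ∈ Metric.ball ξ' ε, Function.Injective (nodes j ζ z) ∧
      (∀ h, ampl s (nodes j ζ z) h ≠ 0) ∧ Px (nodes j ζ z) := fun ζ hζ => by
    refine hgood (ζ, z) ?_
    rw [← ball_prod_same]
    exact ⟨Metric.ball_subset_ball (min_le_left _ _) hζ,
      Metric.ball_subset_ball (hρε.trans (min_le_left _ _)) hz⟩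
  have hH : (hessNu s j (m z) z).PosDef :=
    realHessian_posDef (hsmooth.contDiffAt (Metric.isOpen_ball.mem_nhds hmD)) hκ hhess
  have hG : 0 < funG s j (m z) z := funG_pos (hD _ hmD).1 (hD _ hmD).2.1 hH
  have hloc := densityIntegral_isEquivalent Metric.isOpen_ball (convex_ball ξ' ε)
    (fun ζ hζ => (hD ζ hζ).1) hmD hsmooth hcrit hκ hquad hH hG
    (C := |reducedIntegral s 0 ξ| + 1)
    ((hPσ.filter_mono nhdsWithin_le_nhds).mono fun σ hσ ζ hζ => (hredP hσ (hD ζ hζ).2.2).le)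
  refine ⟨⟨hmD, fun w hw hne => ?_⟩, hH, hG, ?_, hloc⟩
  · have h1 := hquad w hw
    have h2 : 0 < ‖w - m z‖ := norm_pos_iff.2 (sub_ne_zero.2 hne)
    have h3 : 0 < κ / 2 * ‖w - m z‖ ^ 2 := by positivity
    linarith
  · refine condensedDensity_isEquivalent hε hsep hperm ?_ hmδ hG hloc
    rw [← dist_eq_norm]
    exact lt_of_lt_of_le hz hρε
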